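/- **Setting.** Let $E_j=i\lambda_j/\sqrt2$ ($1\le j\le 8$, $\lambda_j$ the Gell-Mann matrices) be the basis of $\mathfrak{su}(3)$ that is orthonormal for $\langle X|Y\rangle=\operatorname{tr}(X^\dagger Y)$, with coordinates $x_j$ and structure constants $[E_j,E_k]=\sum_l c^l_{jk}E_l$. Let $\{F,G\}=\sum_{j,k,l}c^l_{kj}\,x_l\,\partial_jF\,\partial_kG$ be the Poisson bracket on the complex polynomials $Poly(\mathfrak{su}(3))$. The dominant weights are $\omega_{(p,q)}=p\varpi_1+q\varpi_2\in\mathfrak{su}(3)$, $p,q\in\mathbb N_0$, with $\varpi_1=\frac1{\sqrt2}E_3+\frac1{\sqrt6}E_8$ and $\varpi_2=\sqrt{2/3}\,E_8$; the corresponding functional on diagonal matrices is $D\mapsto\operatorname{tr}(D(-i\omega))$, and upper triangular matrices are raising operators. Let $\xi=\sqrt{3/2}\,(x\varpi_1+y\varpi_2)$ with $x,y\ge0$, $x^2+xy+y^2=1$, be such that its adjoint orbit $\mathcal O_\xi=\{g\xi g^{-1}:g\in SU(3)\}$ is rational, i.e. a positive multiple of the orbit of some dominant weight. Put $r(\xi)=\min\{R>0: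 R\xi\text{ is a dominant weight}\}$ and $\omega_\xi=r(\xi)\xi$. Let $Poly(\mathcal O_\xi)$ be the set of restrictions to $\mathcal O_\xi$ of elements of $Poly(\mathfrak{su}(3))$, with the Poisson bracket $\{F_1|_{\mathcal O_\xi},F_2|_{\mathcal O_\xi}\}=\{F_1,F_2\}|_{\mathcal O_\xi}$. For each $s$ let $\mathcal H_s$ be an irreducible unitary representation of $SU(3)$ with highest weight $s\,\omega_\xi$, let $\rho_s:U(\mathfrak{sl}(3))\to\mathcal B(\mathcal H_s)$ be the induced representation of the universal enveloping algebra, and let $\Pi_>$ be the orthogonal projection onto the highest weight line, $\Pi_>^g=g\,\Pi_>\,g^{-1}$. The universal Berezin correspondence is $$b^s_\xi:U(\mathfrak{sl}(3))\to Poly(\mathcal O_\xi),\qquad b^s_\xi[u](g\xi g^{-1})=\operatorname{tr}(\rho_s(u)\,\Pi_>^g),$$ and the twisted product $\star^s_\xi$ on its image is given by $b^s_\xi[u]\star^s_\xi b^s_\xi[v]=b^s_\xi[uv]$. **Theorem.** For every $s\ge1$, $b^s_\xi$ and $\star^s_\xi$ are well defined, and $b^s_\xi$ takes values in $Poly(\mathcal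 O_\xi)$. Every $f\in Poly(\mathcal O_\xi)$ lies in the image of $b^s_\xi$ for all sufficiently large $s$. For all $f_1,f_2\in Poly(\mathcal O_\xi)$, as $s\to\infty$, $$f_1\star^s_\xi f_2\to f_1f_2,\qquad s\,r(\xi)\,\bigl(f_1\star^s_\xi f_2-f_2\star^s_\xi f_1\bigr)\to i\{f_1,f_2\}$$ uniformly on $\mathcal O_\xi$. That is, the Berezin fuzzy $\xi$-orbit is of Poisson type. -/

import Mathlib

open scoped Matrix

noncomputable section

namespace Quark

attribute [local instance 100] LieRing.ofAssociativeRing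

/-- `3 × 3` complex matrices. -/
abbrev Mat3 : Type := Matrix (Fin 3) (Fin 3) ℂ

/-- The group `SU(3)`. -/
abbrev SU3 : Type := Matrix.specialUnitaryGroup (Fin 3) ℂ

/-- The Lie algebra `𝔰𝔩(3) = 𝔰𝔩(3, ℂ)`, the complexification of `𝔰𝔲(3)`. -/
abbrev sl3 : LieSubalgebra ℂ Mat3 := LieAlgebra.SpecialLinear.sl (Fin 3) ℂ

/-- The universal enveloping algebra `U(𝔰𝔩(3))`. -/
abbrev Usl3 : Type := UniversalEnvelopingAlgebra ℂ sl3

/-- The Gell-Mann matrices `λ₁, …, λ₈` (indexed from `0`). -/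
def gellMann : Fin 8 → Mat3 :=
  ![!![0, 1, 0; 1, 0, 0; 0, 0, 0],
    !![0, -Complex.I, 0; Complex.I, 0, 0; 0, 0, 0],
    !![1, 0, 0; 0, -1, 0; 0, 0, 0],
    !![0, 0, 1; 0, 0, 0; 1, 0, 0],
    !![0, 0, -Complex.I; 0, 0, 0; Complex.I, 0, 0],
    !![0, 0, 0; 0, 0, 1; 0, 1, 0],
    !![0, 0, 0; 0, 0, -Complex.I; 0, Complex.I, 0],
    ((1 / Real.sqrt 3 : ℝ) : ℂ) • !![1, 0, 0; 0, 1, 0; 0, 0, -2]]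

/-- The basis `E_j = i λ_j / √2` of `𝔰𝔲(3)`, orthonormal for `⟨X|Y⟩ = tr(X† Y)`. -/
def E (j : Fin 8) : Mat3 := (Complex.I / ((Real.sqrt 2 : ℝ) : ℂ)) • gellMann j

/-- The coordinates `x_j(X) = ⟨E_j|X⟩` with respect to the basis `E`. -/
def coord (X : Mat3) (j : Fin 8) : ℂ := ((E j)ᴴ * X).trace

/-- The structure constants `c^l_{jk}`: `[E_j, E_k] = ∑_l c^l_{jk} E_l`. -/
def structConst (j k l : Fin 8) : ℂ := coord (E j * E k - E k * E j) l

/-- `Poly(𝔰𝔲(3))`: complex polynomials in the coordinates `x_1, …, x_8`. -/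
abbrev PolySu3 : Type := MvPolynomial (Fin 8) ℂ

/-- The Poisson bracket on `Poly(𝔰𝔲(3))` of the bivector
`Π = ∑_{j,k,l} c^l_{kj} x_l ∂_j ⊗ ∂_k`. -/
def poissonBracket (F G : PolySu3) : PolySu3 :=
  ∑ j, ∑ k, ∑ l, MvPolynomial.C (structConst k j l) * MvPolynomial.X l *
    (MvPolynomial.pderiv j F * MvPolynomial.pderiv k G)

/-- The fundamental weight `ϖ₁`, as an element of `𝔰𝔲(3)`. -/
def fundWeight₁ : Mat3 := (1 / Real.sqrt 2 : ℝ) • E 2 + (1 / Real.sqrt 6 : ℝ) • E 7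

/-- The fundamental weight `ϖ₂`, as an element of `𝔰𝔲(3)`. -/
def fundWeight₂ : Mat3 := Real.sqrt (2 / 3) • E 7

/-- The dominant weight `ω_(p,q) = p ϖ₁ + q ϖ₂`. -/
def domWeight (p q : ℕ) : Mat3 := (p : ℝ) • fundWeight₁ + (q : ℝ) • fundWeight₂

/-- `ω ∈ 𝔰𝔲(3)` is a dominant weight. -/
def IsDominantWeight (ω : Mat3) : Prop := ∃ p q : ℕ, ω = domWeight p q

/-- `Ad_g(X) = g X g⁻¹`. -/
def Ad (g : SU3) (X : Mat3) : Mat3 := (g : Mat3) * X * ((g⁻¹ : SU3) : Mat3)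

/-- The adjoint orbit `O_ξ` of `ξ`. -/
def orbit (ξ : Mat3) : Set Mat3 := Set.range fun g : SU3 => Ad g ξ

/-- The point `Ad_g(ξ)` of `O_ξ`. -/
def orbitPt (ξ : Mat3) (g : SU3) : orbit ξ := ⟨Ad g ξ, g, rfl⟩

/-- The arc of unit vectors of the closed principal Weyl chamber: the points
`ξ_(x,y) = √(3/2) (x ϖ₁ + y ϖ₂)` with `x, y ≥ 0` and `x² + xy + y² = 1`. -/
def arc : Set Mat3 :=
  {ξ | ∃ x y : ℝ, 0 ≤ x ∧ 0 ≤ y ∧ x ^ 2 + x * y + y ^ 2 = 1 ∧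
    ξ = Real.sqrt (3 / 2) • (x • fundWeight₁ + y • fundWeight₂)}

/-- Equivalence of orbits by rescaling. -/
def OrbitEquiv (O O' : Set Mat3) : Prop :=
  ∃ α : ℝ, 0 < α ∧ Set.BijOn (fun v => α • v) O O'

/-- The points `ξ` of the arc whose orbit is rational, that is, equivalent to
the orbit of a dominant weight. -/
def rationalArc : Set Mat3 :=
  {ξ ∈ arc | ∃ p q : ℕ, OrbitEquiv (orbit (domWeight p q)) (orbit ξ)}

/-- The integral radius `r(ξ) = min {R > 0 : R ξ is a dominant weight}`. -/
def integralRadius (ξ : Mat3) : ℝ := sInf {R : ℝ | 0 < R ∧ IsDominantWeight (R • ξ)}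

/-- The first dominant weight `ω_ξ = r(ξ) ξ`. -/
def firstWeight (ξ : Mat3) : Mat3 := integralRadius ξ • ξ

/-- The restriction to `O_ξ` of a polynomial on `𝔰𝔲(3)`. -/
def restrict (ξ : Mat3) (F : PolySu3) : orbit ξ → ℂ :=
  fun X => MvPolynomial.eval (coord (X : Mat3)) F

/-- `Poly(O_ξ)`: the restrictions to `O_ξ` of the polynomials on `𝔰𝔲(3)`. -/
def polyOrbit (ξ : Mat3) : Set (orbit ξ → ℂ) := Set.range (restrict ξ)

universe u

/-- A quantum quark system with highest weight `ω`: an irreducible unitary representation of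
`SU(3)` on a finite-dimensional Hilbert space, with its infinitesimal representation,
whose highest weight is `ω`. A linear functional on the Cartan subalgebra of diagonal matrices is
identified with the element `ω` of `𝔰𝔲(3)` by `D ↦ tr(D (-iω))`. -/
structure QuarkSystem (ω : Mat3) where
  /-- the Hilbert space -/
  H : Type u
  [normed : NormedAddCommGroup H]
  [inner : InnerProductSpace ℂ H]
  [finDim : FiniteDimensional ℂ H]
  /-- the unitary representation of the group -/
  rep : SU3 →* (H ≃ₗᵢ[ℂ] H)
  /-- the induced representation of the complexified Lie algebra -/
  drep : sl3 →ₗ⁅ℂ⁆ Module.End ℂ H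
  /-- On `𝔰𝔲(3)`, `drep` is the differential of `rep` at the identity. -/
  hasDerivAt_rep : ∀ X : sl3, (X : Mat3)ᴴ = -(X : Mat3) →
    ∀ γ : ℝ → SU3, (∀ t : ℝ, (γ t : Mat3) = NormedSpace.exp (t • (X : Mat3))) →
      ∀ v : H, HasDerivAt (fun t : ℝ => rep (γ t) v) (drep X v) 0
  irreducible : ∀ W : Submodule ℂ H, (∀ g : SU3, ∀ v ∈ W, rep g v ∈ W) → W = ⊥ ∨ W = ⊤
  /-- a highest weight unit vector; it spans the highest weight subspace -/
  hwVec : H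
  norm_hwVec : ‖hwVec‖ = 1
  drep_upper : ∀ X : sl3, (∀ i j : Fin 3, j ≤ i → (X : Mat3) i j = 0) → drep X hwVec = 0
  drep_diag : ∀ X : sl3, (X : Mat3).IsDiag →
    drep X hwVec = ((X : Mat3) * (-Complex.I • ω)).trace • hwVec

attribute [instance] QuarkSystem.normed QuarkSystem.inner QuarkSystem.finDim

namespace QuarkSystem

variable {ω : Mat3} (Q : QuarkSystem.{u} ω)

/-- The representation `ρ_ω` of `U(𝔰𝔩(3))` on the Hilbert space. -/
def univRep : Usl3 →ₐ[ℂ] Module.End ℂ Q.H := UniversalEnvelopingAlgebra.lift ℂ Q.drep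

/-- The operator by which `g ∈ SU(3)` acts. -/
def op (g : SU3) : Module.End ℂ Q.H := (Q.rep g).toLinearEquiv.toLinearMap

/-- `Π_>`, the orthogonal projection onto the highest weight subspace. -/
def hwProj : Module.End ℂ Q.H := ((ℂ ∙ Q.hwVec).starProjection : Q.H →L[ℂ] Q.H)

/-- `Π_>^g = ρ(g) Π_> ρ(g)⁻¹`. -/
def hwProjAt (g : SU3) : Module.End ℂ Q.H := Q.op g * Q.hwProj * Q.op g⁻¹

/-- The Berezin correspondence `B : 𝓑(H) → Fun(O_ξ)`, `B_A(Ad_g(ξ)) = tr(A Π_>^g)`; at each point of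
the orbit some `g` is chosen. That the value does not depend on this choice, if `ω` is a positive
multiple of `ξ` in `arc`, is `IsBerezin` below. -/
def berezinSymbol (ξ : Mat3) : Module.End ℂ Q.H →ₗ[ℂ] (orbit ξ → ℂ) :=
  LinearMap.pi fun X => (LinearMap.trace ℂ Q.H).comp
    (LinearMap.mulRight ℂ (Q.hwProjAt X.2.choose))

/-- The universal Berezin correspondence `b = B ∘ ρ_ω`. -/
def univBerezin (ξ : Mat3) : Usl3 →ₗ[ℂ] (orbit ξ → ℂ) :=
  (Q.berezinSymbol ξ).comp Q.univRep.toLinearMap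

/-- `w` is a map `U(𝔰𝔩(3)) → Poly(O_ξ)` with `w[u](Ad_g(ξ)) = tr(ρ_ω(u) Π_>^g)` for all `u`, `g`. -/
def IsBerezin (ξ : Mat3) (w : Usl3 →ₗ[ℂ] (orbit ξ → ℂ)) : Prop :=
  ∀ u : Usl3, w u ∈ polyOrbit ξ ∧
    ∀ g : SU3, w u (orbitPt ξ g) = LinearMap.trace ℂ Q.H (Q.univRep u * Q.hwProjAt g)

end QuarkSystem

open Classical in
/-- The twisted product induced by `w : U(𝔰𝔩(3)) → Fun(O_ξ)` on its image: `w[u] ⋆ w[v] = w[uv]`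
(with the value `0` outside the image). -/
def twistedProd {ξ : Mat3} (w : Usl3 →ₗ[ℂ] (orbit ξ → ℂ)) (f₁ f₂ : orbit ξ → ℂ) : orbit ξ → ℂ :=
  if h : (∃ u, w u = f₁) ∧ (∃ v, w v = f₂) then w (h.1.choose * h.2.choose) else 0

/-- `w[u] ⋆ w[v] = w[uv]` holds for all `u`, `v`: the twisted product is well defined. -/
def TwistedProdWellDefined {ξ : Mat3} (w : Usl3 →ₗ[ℂ] (orbit ξ → ℂ)) : Prop :=
  ∀ u v : Usl3, twistedProd w (w u) (w v) = w (u * v)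

/-- The commutator of the twisted product. -/
def twistedComm {ξ : Mat3} (w : Usl3 →ₗ[ℂ] (orbit ξ → ℂ)) (f₁ f₂ : orbit ξ → ℂ) : orbit ξ → ℂ :=
  twistedProd w f₁ f₂ - twistedProd w f₂ f₁

/-- A `ξ`-ray `(w^s)_s` is of Poisson type: for all `f₁, f₂ ∈ Poly(O_ξ)`,
`f₁ ⋆^s f₂ → f₁ f₂` and `s r(ξ) [f₁, f₂]_{⋆^s} → i {f₁, f₂}` uniformly on `O_ξ`. The bracket of
`f₁ = F₁|_{O_ξ}` and `f₂ = F₂|_{O_ξ}` is `{F₁, F₂}|_{O_ξ}`; the statement is made for all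
polynomials `F₁, F₂` that restrict to `f₁, f₂`. The first clause says that `f₁`, `f₂`
are in the domain of `⋆^s` for all large `s`. -/
def IsPoissonType (ξ : Mat3) (w : ℕ → Usl3 →ₗ[ℂ] (orbit ξ → ℂ)) : Prop :=
  (∀ f ∈ polyOrbit ξ, ∃ s₀ : ℕ, ∀ s ≥ s₀, f ∈ Set.range (w s)) ∧
  ∀ f₁ ∈ polyOrbit ξ, ∀ f₂ ∈ polyOrbit ξ,
    TendstoUniformly (fun s : ℕ => twistedProd (w s) f₁ f₂) (f₁ * f₂) Filter.atTop ∧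
    ∀ F₁ F₂ : PolySu3, restrict ξ F₁ = f₁ → restrict ξ F₂ = f₂ →
      TendstoUniformly (fun s : ℕ => ((s : ℝ) * integralRadius ξ) • twistedComm (w s) f₁ f₂)
        (Complex.I • restrict ξ (poissonBracket F₁ F₂)) Filter.atTop

end Quark

end

/-!
The symbol of an operator `A` on `H_s` is the function `tr(A Π_>^g)` on the orbit. As the highest
weight vector is killed by raising operators, left multiplication of `A` by `X ∈ 𝔰𝔩(3)` acts on
symbols as a first order differential operator: the order zero term is multiplication by
`i s r(ξ)` times a linear function, and the order one term does not depend on `s`. Hence all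
symbols are polynomials, and the operators with vanishing symbol form a left ideal, which is zero
by irreducibility.

The Cartan component of `H_s ⊗ H_1` is `H_{s+1}`, and compressing `A ⊗ B` to it multiplies
symbols without increasing norms. So every polynomial `P` is, for large `s`, the symbol of an
operator `Op_s(P)` with norm bounded in `s`. The formula for left multiplication gives
`Op_s(x_j P) = Op_s(x_j) Op_s(P) + O(1/s)`, from which `Op_s(P R) = Op_s(P) Op_s(R) + O(1/s)` by
induction on `P`. For `P = x_j` the operator `s r(ξ) [Op_s(P), Op_s(R)]` is exactly
`i Op_s({P, R})`, and both sides are derivations in `P` up to `O(1/s)`. Symbols are bounded by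
operator norms, so these estimates give uniform convergence.
-/

open scoped Matrix
noncomputable section
namespace Quark
attribute [local instance 100] LieRing.ofAssociativeRing
open scoped InnerProductSpace TensorProduct
open Filter
universe u

section MatrixExponential

variable {n : Type*} [Fintype n] [DecidableEq n]

open scoped Matrix.Norms.L2Operator in
lemma starAlgEquiv_exp (φ : Matrix n n ℂ ≃⋆ₐ[ℂ] Matrix n n ℂ) (X : Matrix n n ℂ) :
    φ (NormedSpace.exp X) = NormedSpace.exp (φ X) :=
  NormedSpace.map_exp_of_mem_ball (𝕂 := ℂ) φ
    (LinearMap.continuous_of_finiteDimensional φ.toAlgEquiv.toLinearMap) X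
    (by simp [NormedSpace.expSeries_radius_eq_top])

lemma exp_conj_diagonal (U : Matrix.unitaryGroup n ℂ) (d : n → ℂ) :
    NormedSpace.exp (Unitary.conjStarAlgAut ℂ _ U (Matrix.diagonal d)) =
      Unitary.conjStarAlgAut ℂ _ U (Matrix.diagonal fun i => Complex.exp (d i)) := by
  rw [← starAlgEquiv_exp, Matrix.exp_diagonal, Complex.exp_eq_exp_ℂ, Pi.exp_def]

lemma det_conj_unitary (U : Matrix.unitaryGroup n ℂ) (X : Matrix n n ℂ) :
    (Unitary.conjStarAlgAut ℂ _ U X).det = X.det := by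
  rw [Unitary.conjStarAlgAut_apply, Matrix.det_mul_right_comm,
    Unitary.mul_star_self_of_mem U.2, one_mul]

lemma trace_conj_unitary (U : Matrix.unitaryGroup n ℂ) (X : Matrix n n ℂ) :
    (Unitary.conjStarAlgAut ℂ _ U X).trace = X.trace := by
  rw [Unitary.conjStarAlgAut_apply, Matrix.trace_mul_cycle, Unitary.coe_star_mul_self, one_mul]

lemma exists_eq_conj_diagonal_of_conjTranspose_eq_neg {X : Matrix n n ℂ} (hX : Xᴴ = -X) :
    ∃ (U : Matrix.unitaryGroup n ℂ) (θ : n → ℝ),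
      X = Unitary.conjStarAlgAut ℂ _ U (Matrix.diagonal fun i => (θ i : ℂ) * Complex.I) := by
  have hH : (-Complex.I • X).IsHermitian := by
    simp [Matrix.IsHermitian, Matrix.conjTranspose_smul, hX]
  refine ⟨hH.eigenvectorUnitary, hH.eigenvalues, ?_⟩
  calc X = Complex.I • (-Complex.I • X) := by simp [smul_smul]
    _ = _ := congrArg (Complex.I • ·) hH.spectral_theorem
    _ = _ := by
      simp only [← map_smul, ← Matrix.diagonal_smul]
      congr 2
      ext i
      simp [mul_comm]

open scoped Matrix.Norms.L2Operator in
lemma exists_exp_eq_of_mem_unitaryGroup {u : Matrix n n ℂ} (hu : u ∈ Matrix.unitaryGroup n ℂ) :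
    ∃ X : Matrix n n ℂ, Xᴴ = -X ∧ NormedSpace.exp X = u := by
  have hu_normal : IsStarNormal u :=
    ⟨(Unitary.star_mul_self_of_mem hu).trans (Unitary.mul_star_self_of_mem hu).symm⟩
  have hcont (f : ℂ → ℂ) : ContinuousOn f (spectrum ℂ u) :=
    (Matrix.finite_spectrum u).continuousOn f
  have harg := hcont fun z => Complex.I * (z.arg : ℂ)
  refine ⟨cfc (fun z : ℂ => Complex.I * (z.arg : ℂ)) u, ?_, ?_⟩
  · rw [← Matrix.star_eq_conjTranspose, ← cfc_star, ← cfc_neg]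
    simp
  · rw [← CFC.exp_eq_normedSpace_exp (𝕜 := ℂ), ← cfc_comp' ..]
    conv_rhs => rw [← cfc_id' ℂ u]
    refine cfc_congr fun z hz => ?_
    have hz_norm : ‖z‖ = 1 := spectrum.norm_eq_one_of_unitary hu hz
    simpa [hz_norm, mul_comm, ← Complex.exp_eq_exp_ℂ] using Complex.norm_mul_exp_arg_mul_I z

lemma exp_mem_specialUnitaryGroup {X : Matrix n n ℂ} (hX : Xᴴ = -X) (htr : X.trace = 0) :
    NormedSpace.exp X ∈ Matrix.specialUnitaryGroup n ℂ := by
  rw [Matrix.mem_specialUnitaryGroup_iff, Matrix.mem_unitaryGroup_iff]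
  constructor
  · rw [Matrix.star_eq_conjTranspose, ← Matrix.exp_conjTranspose, hX, Matrix.exp_neg]
    exact Matrix.mul_nonsing_inv _ ((Matrix.isUnit_iff_isUnit_det _).1 (Matrix.isUnit_exp X))
  · obtain ⟨U, θ, rfl⟩ := exists_eq_conj_diagonal_of_conjTranspose_eq_neg hX
    rw [trace_conj_unitary, Matrix.trace_diagonal] at htr
    rw [exp_conj_diagonal, det_conj_unitary, Matrix.det_diagonal, ← Complex.exp_sum, htr,
      Complex.exp_zero]

lemma exists_exp_eq_of_mem_specialUnitaryGroup {u : Matrix n n ℂ}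
    (hu : u ∈ Matrix.specialUnitaryGroup n ℂ) :
    ∃ X : Matrix n n ℂ, Xᴴ = -X ∧ X.trace = 0 ∧ NormedSpace.exp X = u := by
  obtain hn | ⟨⟨i₀⟩⟩ := isEmpty_or_nonempty n
  · exact ⟨0, by simp, by simp, Subsingleton.elim _ _⟩
  obtain ⟨hunitary, hdet⟩ := Matrix.mem_specialUnitaryGroup_iff.1 hu
  obtain ⟨X, hX, rfl⟩ := exists_exp_eq_of_mem_unitaryGroup hunitary
  obtain ⟨U, θ, rfl⟩ := exists_eq_conj_diagonal_of_conjTranspose_eq_neg hX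
  rw [exp_conj_diagonal, det_conj_unitary, Matrix.det_diagonal, ← Complex.exp_sum,
    Complex.exp_eq_one_iff] at hdet
  obtain ⟨k, hk⟩ := hdet
  -- The angles sum to `2πk`; subtracting `2πk` from one of them does not change the exponential.
  let θ' : n → ℝ := θ - Pi.single i₀ (2 * Real.pi * k)
  refine ⟨Unitary.conjStarAlgAut ℂ _ U (Matrix.diagonal fun i => (θ' i : ℂ) * Complex.I),
    ?_, ?_, ?_⟩
  · rw [← Matrix.star_eq_conjTranspose, ← map_star, ← map_neg, Matrix.star_eq_conjTranspose,
      Matrix.diagonal_conjTranspose, Matrix.diagonal_neg]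
    congr 2
    ext i
    simp
  · rw [trace_conj_unitary, Matrix.trace_diagonal]
    simp only [θ', Pi.sub_apply, Complex.ofReal_sub, sub_mul, Finset.sum_sub_distrib, hk,
      ← Finset.sum_mul, ← Complex.ofReal_sum, Finset.sum_pi_single', Finset.mem_univ, if_true]
    push_cast
    ring
  · rw [exp_conj_diagonal, exp_conj_diagonal]
    congr 2
    ext i
    rw [Complex.exp_eq_exp_iff_exists_int]
    obtain rfl | hi := eq_or_ne i i₀
    · exact ⟨-k, by simp [θ']; ring⟩
    · exact ⟨0, by simp [θ', hi]⟩

end MatrixExponential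

section SpecialUnitary

lemma trace_sl3 (X : sl3) : (X : Mat3).trace = 0 :=
  LinearMap.mem_ker.1 X.2

/-- The real form `𝔰𝔲(3)` of `𝔰𝔩(3)`: the skew-Hermitian traceless matrices. -/
abbrev su3 : Type := {X : sl3 // (X : Mat3)ᴴ = -(X : Mat3)}

/-- The one-parameter subgroup `t ↦ exp(tX)` of `SU(3)` generated by `X ∈ 𝔰𝔲(3)`. -/
def oneParam (X : su3) (t : ℝ) : SU3 :=
  ⟨NormedSpace.exp (t • (X : Mat3)),
    exp_mem_specialUnitaryGroup (by simp [X.2]) (by simp [trace_sl3])⟩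

lemma coe_oneParam (X : su3) (t : ℝ) :
    (oneParam X t : Mat3) = NormedSpace.exp (t • (X : Mat3)) := rfl

lemma oneParam_zero (X : su3) : oneParam X 0 = 1 := by
  ext1; simp [coe_oneParam]

lemma oneParam_add (X : su3) (s t : ℝ) : oneParam X (s + t) = oneParam X s * oneParam X t := by
  ext1
  rw [Submonoid.coe_mul, coe_oneParam, coe_oneParam, coe_oneParam, add_smul]
  exact Matrix.exp_add_of_commute _ _ (((Commute.refl _).smul_left s).smul_right t)

lemma exists_oneParam_one_eq (g : SU3) : ∃ X : su3, oneParam X 1 = g := by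
  obtain ⟨X, hX, htr, hexp⟩ := exists_exp_eq_of_mem_specialUnitaryGroup g.2
  exact ⟨⟨⟨X, LinearMap.mem_ker.2 htr⟩, hX⟩, Subtype.ext (by simp [coe_oneParam, hexp])⟩

/-- The conjugate transpose on `𝔰𝔩(3)`; on a unitary representation it becomes the adjoint. -/
def adj (X : sl3) : sl3 := ⟨(X : Mat3)ᴴ, LinearMap.mem_ker.2 (by simp [trace_sl3])⟩

@[simp] lemma coe_adj (X : sl3) : (adj X : Mat3) = (X : Mat3)ᴴ := rfl

lemma exists_eq_add_I_smul (X : sl3) :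
    ∃ A B : su3, X = A + Complex.I • (B : sl3) ∧ adj X = -A + Complex.I • (B : sl3) := by
  have hI : Complex.I * (-Complex.I / 2) = 1 / 2 := by linear_combination (-1/2) * Complex.I_mul_I
  refine ⟨⟨(1 / 2 : ℂ) • (X - adj X), ?_⟩, ⟨(-Complex.I / 2) • (X + adj X), ?_⟩, ?_, ?_⟩
  · simp [Matrix.conjTranspose_smul, ← smul_neg]
  · simp [Matrix.conjTranspose_smul, add_comm, neg_div]
  · rw [smul_smul, hI]; module
  · rw [smul_smul, hI]; module

end SpecialUnitary

section Adjoint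

/-- The adjoint action of `SU(3)` on matrices, as `⋆`-algebra automorphisms. -/
def adAut : SU3 →* (Mat3 ≃⋆ₐ[ℂ] Mat3) :=
  (Unitary.conjStarAlgAut ℂ Mat3).comp
    (Submonoid.inclusion Matrix.specialUnitaryGroup_le_unitaryGroup)

lemma Ad_eq_adAut (g : SU3) (X : Mat3) : Ad g X = adAut g X := by
  rw [Ad, ← Matrix.star_eq_inv]; rfl

lemma Ad_one (X : Mat3) : Ad 1 X = X := by simp [Ad_eq_adAut]

lemma Ad_inv_Ad (g : SU3) (X : Mat3) : Ad g⁻¹ (Ad g X) = X := by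
  rw [Ad_eq_adAut, Ad_eq_adAut, ← StarAlgEquiv.mul_apply, ← map_mul, inv_mul_cancel, map_one,
    StarAlgEquiv.one_apply]

lemma trace_Ad (g : SU3) (X : Mat3) : (Ad g X).trace = X.trace := by
  rw [Ad_eq_adAut]; exact trace_conj_unitary _ X

/-- The adjoint action of `SU(3)` on `𝔰𝔩(3)`. -/
def AdSl (g : SU3) : sl3 →ₗ[ℂ] sl3 :=
  (adAut g).toAlgEquiv.toLinearMap.restrict fun X hX =>
    LinearMap.mem_ker.2 (((congrArg _ (Ad_eq_adAut g X)).symm.trans (trace_Ad g X)).trans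
      (LinearMap.mem_ker.1 hX))

@[simp] lemma coe_AdSl (g : SU3) (X : sl3) : (AdSl g X : Mat3) = Ad g X :=
  (Ad_eq_adAut g X).symm

/-- The adjoint action of `SU(3)` on `𝔰𝔲(3)`. -/
def AdSu (g : SU3) (X : su3) : su3 :=
  ⟨AdSl g X, by
    rw [coe_AdSl, Ad_eq_adAut, ← Matrix.star_eq_conjTranspose, ← map_star,
      Matrix.star_eq_conjTranspose, X.2, map_neg]⟩

lemma oneParam_AdSu (g : SU3) (X : su3) (t : ℝ) :
    oneParam (AdSu g X) t = g * oneParam X t * g⁻¹ := by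
  ext1
  calc NormedSpace.exp (t • (AdSl g X : Mat3))
      = NormedSpace.exp (adAut g (t • (X : Mat3))) := by
        rw [coe_AdSl, Ad_eq_adAut, ← Complex.coe_smul, ← Complex.coe_smul, map_smul]
    _ = Ad g (oneParam X t) := by rw [← starAlgEquiv_exp, Ad_eq_adAut, coe_oneParam]

end Adjoint

section GellMann

lemma gellMann_conjTranspose (j : Fin 8) : (gellMann j)ᴴ = gellMann j := by
  fin_cases j <;> ext a b <;> fin_cases a <;> fin_cases b <;>
    simp [gellMann, Matrix.conjTranspose_apply]

lemma E_conjTranspose (j : Fin 8) : (E j)ᴴ = -(E j) := by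
  rw [E, Matrix.conjTranspose_smul, gellMann_conjTranspose, ← neg_smul]
  congr 1
  simp [neg_div]

lemma trace_E (j : Fin 8) : (E j).trace = 0 := by
  fin_cases j <;> simp [E, gellMann, Matrix.trace, Fin.sum_univ_three]
  ring

/-- `E_j` as an element of `𝔰𝔲(3)`. -/
def Esu (j : Fin 8) : su3 := ⟨⟨E j, LinearMap.mem_ker.2 (trace_E j)⟩, E_conjTranspose j⟩

@[simp] lemma coe_Esu (j : Fin 8) : (Esu j : Mat3) = E j := rfl

lemma coord_eq (X : Mat3) (j : Fin 8) : coord X j = -(E j * X).trace := by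
  simp [coord, E_conjTranspose]

lemma coord_smul (c : ℂ) (X : Mat3) (k : Fin 8) : coord (c • X) k = c * coord X k := by
  simp [coord]

lemma coord_sum {ι : Type*} (s : Finset ι) (f : ι → Mat3) (k : Fin 8) :
    coord (∑ i ∈ s, f i) k = ∑ i ∈ s, coord (f i) k := by
  simp [coord, Finset.mul_sum, Matrix.trace_sum]

lemma coord_smul_E (X : Mat3) (j : Fin 8) :
    coord X j • E j = ((gellMann j * X).trace / 2) • gellMann j := by
  have hsqrt : ((Real.sqrt 2 : ℝ) : ℂ) ^ 2 = 2 := by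
    rw [← Complex.ofReal_pow, Real.sq_sqrt zero_le_two, Complex.ofReal_ofNat]
  have hsqrt_ne : ((Real.sqrt 2 : ℝ) : ℂ) ≠ 0 := by
    simp
  rw [coord_eq, E, smul_smul, Matrix.smul_mul, Matrix.trace_smul, smul_eq_mul]
  congr 1
  field_simp
  rw [Complex.I_sq, hsqrt]
  ring

lemma eq_sum_coord_smul_E {X : Mat3} (hX : X.trace = 0) : X = ∑ k, coord X k • E k := by
  set c : ℂ := ((Real.sqrt 3 : ℝ) : ℂ)⁻¹ with hc
  have hc2 : c * c = 1 / 3 := by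
    rw [hc, ← mul_inv, ← Complex.ofReal_mul, Real.mul_self_sqrt zero_le_three]; simp
  have hI := Complex.I_mul_I
  have hX2 : X 2 2 = -(X 0 0) - X 1 1 := by
    rw [Matrix.trace_fin_three] at hX; linear_combination hX
  simp_rw [coord_smul_E]
  ext a b
  fin_cases a <;> fin_cases b <;>
    simp [Fin.sum_univ_eight, gellMann, Matrix.trace_fin_three, Matrix.mul_apply,
      Fin.sum_univ_three, hX2, ← hc]
  · linear_combination (-3/2 * (X 0 0 + X 1 1)) * hc2
  · linear_combination ((X 0 1 - X 1 0) / 2) * hI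
  · linear_combination ((X 0 2 - X 2 0) / 2) * hI
  · linear_combination ((X 1 0 - X 0 1) / 2) * hI
  · linear_combination (-3/2 * (X 0 0 + X 1 1)) * hc2
  · linear_combination ((X 1 2 - X 2 1) / 2) * hI
  · linear_combination ((X 2 0 - X 0 2) / 2) * hI
  · linear_combination ((X 2 1 - X 1 2) / 2) * hI
  · linear_combination (3 * (X 0 0 + X 1 1)) * hc2

lemma sum_coord_mul_coord (Z : Mat3) {X : Mat3} (hX : X.trace = 0) :
    ∑ k, coord X k * coord Z k = -(Z * X).trace := by
  conv_rhs =>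
    rw [eq_sum_coord_smul_E hX, Finset.mul_sum, Matrix.trace_sum, ← Finset.sum_neg_distrib]
  refine Finset.sum_congr rfl fun k _ => ?_
  rw [Matrix.mul_smul, Matrix.trace_smul, Matrix.trace_mul_comm, coord_eq Z, smul_eq_mul, mul_neg]

end GellMann

section Weights

/-- The diagonal element `i diag(d)` of `𝔲(3)`; as a functional on diagonal matrices it is
`D ↦ ∑ₐ Dₐₐ dₐ`. -/
def diagWeight : (Fin 3 → ℝ) →ₗ[ℝ] Mat3 where
  toFun d := Matrix.diagonal fun i => Complex.I * (d i : ℂ)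
  map_add' d e := by simp [mul_add, Matrix.diagonal_add]
  map_smul' c d := by
    rw [RingHom.id_apply, ← Matrix.diagonal_smul]
    congr 1
    ext i
    simp [mul_left_comm]

lemma diagWeight_apply (d : Fin 3 → ℝ) :
    diagWeight d = Matrix.diagonal fun i => Complex.I * (d i : ℂ) := rfl

lemma diagWeight_injective : Function.Injective diagWeight := fun d e h => by
  ext i
  simpa using congrFun (Matrix.diagonal_injective h) i

lemma trace_mul_neg_I_smul_diagWeight (X : Mat3) (d : Fin 3 → ℝ) :
    (X * (-Complex.I • diagWeight d)).trace = ∑ a, X a a * (d a : ℂ) := by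
  rw [diagWeight_apply, ← Matrix.diagonal_smul]
  simp [Matrix.trace, ← mul_assoc]

/-- The diagonal entries of `-i (x ϖ₁ + y ϖ₂)`. -/
def weightEntries (x y : ℝ) : Fin 3 → ℝ := ![(2 * x + y) / 3, (y - x) / 3, -(x + 2 * y) / 3]

lemma smul_weightEntries (c x y : ℝ) : c • weightEntries x y = weightEntries (c * x) (c * y) := by
  ext i
  fin_cases i <;> simp [weightEntries] <;> ring

lemma antitone_weightEntries {x y : ℝ} (hx : 0 ≤ x) (hy : 0 ≤ y) :
    Antitone (weightEntries x y) := by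
  rw [Fin.antitone_iff_succ_le]
  intro i
  fin_cases i <;> simp [weightEntries] <;> linarith

lemma weightEntries_inj {x y x' y' : ℝ} (h : weightEntries x y = weightEntries x' y') :
    x = x' ∧ y = y' := by
  have h0 : (2 * x + y) / 3 = (2 * x' + y') / 3 := congrFun h 0
  have h1 : (y - x) / 3 = (y' - x') / 3 := congrFun h 1
  constructor <;> linarith

lemma E_two : E 2 = diagWeight ((1 / Real.sqrt 2) • ![1, -1, 0]) := by
  ext a b
  fin_cases a <;> fin_cases b <;> simp [E, gellMann, diagWeight_apply, div_eq_mul_inv]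

lemma E_seven : E 7 = diagWeight ((1 / Real.sqrt 6) • ![1, 1, -2]) := by
  have h6 : Real.sqrt 6 = Real.sqrt 2 * Real.sqrt 3 := by
    rw [← Real.sqrt_mul zero_le_two]; norm_num
  ext a b
  fin_cases a <;> fin_cases b <;> simp [E, gellMann, diagWeight_apply, h6] <;> ring

lemma fundWeight₁_eq : fundWeight₁ = diagWeight (weightEntries 1 0) := by
  have h2 : (1 / Real.sqrt 2) * (1 / Real.sqrt 2) = 1 / 2 := by
    rw [div_mul_div_comm, one_mul, Real.mul_self_sqrt zero_le_two]
  have h6 : (1 / Real.sqrt 6) * (1 / Real.sqrt 6) = 1 / 6 := by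
    rw [div_mul_div_comm, one_mul, Real.mul_self_sqrt (by norm_num)]
  rw [fundWeight₁, E_two, E_seven, ← map_smul, ← map_smul, ← map_add, smul_smul, smul_smul, h2, h6]
  congr 1
  ext i
  fin_cases i <;> simp [weightEntries] <;> norm_num

lemma fundWeight₂_eq : fundWeight₂ = diagWeight (weightEntries 0 1) := by
  have h : Real.sqrt (2 / 3) * (1 / Real.sqrt 6) = 1 / 3 := by
    rw [mul_one_div, ← Real.sqrt_div (by norm_num),
      Real.sqrt_eq_iff_mul_self_eq (by norm_num) (by norm_num)]
    norm_num
  rw [fundWeight₂, E_seven, ← map_smul, smul_smul, h]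
  congr 1
  ext i
  fin_cases i <;> simp [weightEntries]
  ring

lemma smul_fundWeight_add (x y : ℝ) :
    x • fundWeight₁ + y • fundWeight₂ = diagWeight (weightEntries x y) := by
  rw [fundWeight₁_eq, fundWeight₂_eq, ← map_smul, ← map_smul, ← map_add]
  congr 1
  ext i
  fin_cases i <;> simp [weightEntries] <;> ring

lemma domWeight_eq (p q : ℕ) : domWeight p q = diagWeight (weightEntries p q) :=
  smul_fundWeight_add p q

lemma exists_eq_diagWeight_of_mem_arc {ξ : Mat3} (hξ : ξ ∈ arc) : ∃ x y : ℝ, 0 ≤ x ∧ 0 ≤ y ∧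
    x ^ 2 + x * y + y ^ 2 = 3 / 2 ∧ ξ = diagWeight (weightEntries x y) := by
  obtain ⟨x, y, hx, hy, hxy, rfl⟩ := hξ
  have hsqrt : Real.sqrt (3 / 2) ^ 2 = 3 / 2 := Real.sq_sqrt (by norm_num)
  refine ⟨Real.sqrt (3 / 2) * x, Real.sqrt (3 / 2) * y, by positivity, by positivity, ?_, ?_⟩
  · linear_combination (x ^ 2 + x * y + y ^ 2) * hsqrt + 3 / 2 * hxy
  · rw [smul_fundWeight_add, ← map_smul, smul_weightEntries]

lemma eq_of_Ad_diagWeight_eq {d e : Fin 3 → ℝ} (hd : Antitone d) (he : Antitone e) {g : SU3}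
    (h : Ad g (diagWeight d) = diagWeight e) : d = e := by
  have hcharpoly : (diagWeight d).charpoly = (diagWeight e).charpoly := by
    rw [← h, Ad, Matrix.charpoly_mul_comm, ← mul_assoc, ← Submonoid.coe_mul, inv_mul_cancel,
      Submonoid.coe_one, one_mul]
  have him_roots (f : Fin 3 → ℝ) :
      (diagWeight f).charpoly.roots.map Complex.im = Finset.univ.val.map f := by
    have hprod : (diagWeight f).charpoly = ((Finset.univ.val.map fun i => Complex.I * (f i : ℂ)).map
        fun z => Polynomial.X - Polynomial.C z).prod := by
      rw [diagWeight_apply, Matrix.charpoly_diagonal, Multiset.map_map]; rfl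
    rw [hprod, Polynomial.roots_multiset_prod_X_sub_C, Multiset.map_map]
    simp
  have hperm : (List.ofFn d).Perm (List.ofFn e) := by
    rw [← Multiset.coe_eq_coe, ← Fin.univ_val_map, ← Fin.univ_val_map, ← him_roots, ← him_roots,
      hcharpoly]
  exact List.ofFn_injective (hperm.eq_of_sortedGE hd.sortedGE_ofFn he.sortedGE_ofFn)

lemma exists_isDominantWeight_smul {ξ : Mat3} (hξ : ξ ∈ rationalArc) :
    ∃ R : ℝ, 0 < R ∧ IsDominantWeight (R • ξ) := by
  obtain ⟨harc, p, q, α, hα, hbij⟩ := hξ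
  obtain ⟨x, y, hx, hy, -, rfl⟩ := exists_eq_diagWeight_of_mem_arc harc
  obtain ⟨g, hg⟩ := hbij.mapsTo ⟨1, Ad_one _⟩
  have hscale : α • weightEntries p q = weightEntries x y := by
    refine (eq_of_Ad_diagWeight_eq (antitone_weightEntries hx hy) ?_ (hg.trans ?_)).symm
    · exact (antitone_weightEntries p.cast_nonneg q.cast_nonneg).const_smul hα.le
    · simp only [domWeight_eq, map_smul]
  refine ⟨α⁻¹, inv_pos.2 hα, p, q, ?_⟩
  rw [← hscale, domWeight_eq, map_smul, inv_smul_smul₀ hα.ne']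

lemma half_le_of_isDominantWeight_smul {ξ : Mat3} (hξ : ξ ∈ arc) {R : ℝ} (hR : 0 < R)
    (h : IsDominantWeight (R • ξ)) : 1 / 2 ≤ R := by
  obtain ⟨x, y, -, -, hxy, rfl⟩ := exists_eq_diagWeight_of_mem_arc hξ
  obtain ⟨p, q, hpq⟩ := h
  rw [domWeight_eq, ← map_smul, smul_weightEntries] at hpq
  obtain ⟨hp, hq⟩ := weightEntries_inj (diagWeight_injective hpq)
  have hpq_norm : R ^ 2 * (3 / 2) = ((p ^ 2 + p * q + q ^ 2 : ℕ) : ℝ) := by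
    push_cast
    rw [← hxy, ← hp, ← hq]
    ring
  have hone_le : (1 : ℝ) ≤ ((p ^ 2 + p * q + q ^ 2 : ℕ) : ℝ) := by
    rw [Nat.one_le_cast, Nat.one_le_iff_ne_zero, ← Nat.cast_ne_zero (R := ℝ), ← hpq_norm]
    positivity
  nlinarith

lemma integralRadius_pos {ξ : Mat3} (hξ : ξ ∈ rationalArc) : 0 < integralRadius ξ :=
  one_half_pos.trans_le <| le_csInf (exists_isDominantWeight_smul hξ) fun _ ⟨hR, hdom⟩ =>
    half_le_of_isDominantWeight_smul hξ.1 hR hdom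

end Weights

section SkewFlow

variable {H : Type*} [NormedAddCommGroup H] [InnerProductSpace ℂ H]

lemma eq_zero_of_hasDerivAt_skew {S : H → H} (hS : ∀ a, ⟪S a, a⟫_ℂ = -⟪a, S a⟫_ℂ) {w : ℝ → H}
    (hw : ∀ t, HasDerivAt w (S (w t)) t) (h0 : w 0 = 0) (t : ℝ) : w t = 0 := by
  have hderiv (t : ℝ) : HasDerivAt (fun t => ⟪w t, w t⟫_ℂ) 0 t := by
    have := (hw t).inner ℂ (hw t)
    rwa [hS, add_neg_cancel] at this
  have hconst := is_const_of_deriv_eq_zero (fun t => (hderiv t).differentiableAt)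
    (fun t => (hderiv t).deriv) t 0
  simpa [h0] using hconst

lemma starProjection_orthogonal_apply_comm {S : H →ₗ[ℂ] H} (hS : ∀ a b, ⟪S a, b⟫_ℂ = -⟪a, S b⟫_ℂ)
    {W : Submodule ℂ H} [W.HasOrthogonalProjection] (hW : ∀ a ∈ W, S a ∈ W) (b : H) :
    Wᗮ.starProjection (S b) = S (Wᗮ.starProjection b) := by
  have hWperp : ∀ a ∈ Wᗮ, S a ∈ Wᗮ := fun a ha => by
    rw [Submodule.mem_orthogonal] at ha ⊢
    intro c hc
    rw [← neg_eq_zero, ← hS, ha _ (hW c hc)]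
  have hzero : Wᗮ.starProjection (S (W.starProjection b)) = 0 := by
    rw [Submodule.starProjection_apply_eq_zero_iff, Submodule.orthogonal_orthogonal]
    exact hW _ (W.starProjection_apply_mem b)
  have hself : Wᗮ.starProjection (S (Wᗮ.starProjection b)) = S (Wᗮ.starProjection b) :=
    Submodule.starProjection_eq_self_iff.2 (hWperp _ (Wᗮ.starProjection_apply_mem b))
  conv_lhs => rw [← W.starProjection_add_starProjection_orthogonal b, map_add, map_add, hzero,
    hself, zero_add]

lemma mem_of_hasDerivAt_skew {S : H →ₗ[ℂ] H} (hS : ∀ a b, ⟪S a, b⟫_ℂ = -⟪a, S b⟫_ℂ)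
    {W : Submodule ℂ H} [W.HasOrthogonalProjection] (hW : ∀ a ∈ W, S a ∈ W) {w : ℝ → H}
    (hw : ∀ t, HasDerivAt w (S (w t)) t) (h0 : w 0 ∈ W) (t : ℝ) : w t ∈ W := by
  have hmem_iff (a : H) : a ∈ W ↔ Wᗮ.starProjection a = 0 := by
    rw [Submodule.starProjection_apply_eq_zero_iff, Submodule.orthogonal_orthogonal]
  rw [hmem_iff] at h0 ⊢
  refine eq_zero_of_hasDerivAt_skew (S := S) (w := fun t => Wᗮ.starProjection (w t))
    (fun a => hS a a) (fun t => ?_) h0 t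
  rw [← starProjection_orthogonal_apply_comm hS hW]
  exact (Wᗮ.starProjection.restrictScalars ℝ).hasFDerivAt.comp_hasDerivAt t (hw t)

end SkewFlow

namespace QuarkSystem

variable {ω : Mat3} (Q : QuarkSystem.{u} ω)

lemma rep_one_apply (a : Q.H) : Q.rep 1 a = a := by rw [map_one]; rfl

lemma rep_mul_apply (g h : SU3) (a : Q.H) : Q.rep (g * h) a = Q.rep g (Q.rep h a) := by
  rw [map_mul]; rfl

lemma rep_inv_rep (g : SU3) (a : Q.H) : Q.rep g⁻¹ (Q.rep g a) = a := by
  rw [← rep_mul_apply, inv_mul_cancel, rep_one_apply]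

lemma rep_rep_inv (g : SU3) (a : Q.H) : Q.rep g (Q.rep g⁻¹ a) = a := by
  rw [← rep_mul_apply, mul_inv_cancel, rep_one_apply]

lemma inner_rep (g : SU3) (a b : Q.H) : ⟪Q.rep g a, Q.rep g b⟫_ℂ = ⟪a, b⟫_ℂ :=
  LinearIsometryEquiv.inner_map_map _ _ _

lemma hasDerivAt_rep_oneParam_zero (X : su3) (a : Q.H) :
    HasDerivAt (fun t => Q.rep (oneParam X t) a) (Q.drep X a) 0 :=
  Q.hasDerivAt_rep X X.2 (oneParam X) (coe_oneParam X) a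

lemma hasDerivAt_rep_oneParam (X : su3) (a : Q.H) (t : ℝ) :
    HasDerivAt (fun t => Q.rep (oneParam X t) a) (Q.drep X (Q.rep (oneParam X t) a)) t := by
  have h := Q.hasDerivAt_rep_oneParam_zero X (Q.rep (oneParam X t) a)
  rw [← sub_self t] at h
  refine (h.comp_sub_const t t).congr_of_eventuallyEq (.of_forall fun s => ?_)
  beta_reduce
  rw [← rep_mul_apply, ← oneParam_add, sub_add_cancel]

lemma inner_drep_of_skew (X : su3) (a b : Q.H) : ⟪Q.drep X a, b⟫_ℂ = -⟪a, Q.drep X b⟫_ℂ := by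
  have h := (Q.hasDerivAt_rep_oneParam_zero X a).inner ℂ (Q.hasDerivAt_rep_oneParam_zero X b)
  simp only [inner_rep, oneParam_zero, rep_one_apply] at h
  linear_combination h.unique (hasDerivAt_const _ _)

lemma inner_drep_adj (X : sl3) (a b : Q.H) : ⟪Q.drep (adj X) a, b⟫_ℂ = ⟪a, Q.drep X b⟫_ℂ := by
  obtain ⟨A, B, hX, hX'⟩ := exists_eq_add_I_smul X
  rw [hX', hX]
  simp only [map_add, map_neg, map_smul, LinearMap.add_apply, LinearMap.neg_apply,
    LinearMap.smul_apply, inner_add_left, inner_add_right, inner_neg_left, inner_smul_left,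
    inner_smul_right, inner_drep_of_skew, Complex.conj_I]
  ring

lemma rep_drep_of_skew (g : SU3) (X : su3) (a : Q.H) :
    Q.rep g (Q.drep X a) = Q.drep (AdSl g X) (Q.rep g a) := by
  have hleft := ((Q.rep g).toContinuousLinearEquiv.toContinuousLinearMap.restrictScalars
    ℝ).hasFDerivAt.comp_hasDerivAt (0 : ℝ) (Q.hasDerivAt_rep_oneParam_zero X a)
  have hright := Q.hasDerivAt_rep_oneParam_zero (AdSu g X) (Q.rep g a)
  refine hleft.unique (hright.congr_of_eventuallyEq (.of_forall fun t => ?_))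
  simp only [oneParam_AdSu, rep_mul_apply, rep_inv_rep]
  rfl

lemma rep_drep (g : SU3) (X : sl3) (a : Q.H) :
    Q.rep g (Q.drep X a) = Q.drep (AdSl g X) (Q.rep g a) := by
  obtain ⟨A, B, hX, -⟩ := exists_eq_add_I_smul X
  rw [hX]
  simp only [map_add, map_smul, LinearMap.add_apply, LinearMap.smul_apply, rep_drep_of_skew]

lemma rep_mem_of_drep_mem {W : Submodule ℂ Q.H} (hW : ∀ X : sl3, ∀ a ∈ W, Q.drep X a ∈ W)
    (g : SU3) {a : Q.H} (ha : a ∈ W) : Q.rep g a ∈ W := by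
  obtain ⟨X, rfl⟩ := exists_oneParam_one_eq g
  refine mem_of_hasDerivAt_skew (Q.inner_drep_of_skew X) (hW X) (Q.hasDerivAt_rep_oneParam X a)
    ?_ 1
  rwa [oneParam_zero, rep_one_apply]

lemma eq_bot_or_eq_top_of_drep_mem {W : Submodule ℂ Q.H}
    (hW : ∀ X : sl3, ∀ a ∈ W, Q.drep X a ∈ W) : W = ⊥ ∨ W = ⊤ :=
  Q.irreducible W fun g _ => Q.rep_mem_of_drep_mem hW g

lemma univRep_ι (X : sl3) : Q.univRep (UniversalEnvelopingAlgebra.ι ℂ X) = Q.drep X :=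
  UniversalEnvelopingAlgebra.lift_ι_apply ℂ Q.drep X

lemma exists_univRep_apply_eq {a : Q.H} (ha : a ≠ 0) (b : Q.H) : ∃ x, Q.univRep x a = b := by
  let W : Submodule ℂ Q.H := LinearMap.range ((LinearMap.applyₗ a).comp Q.univRep.toLinearMap)
  have hW : ∀ X : sl3, ∀ c ∈ W, Q.drep X c ∈ W := by
    rintro X _ ⟨x, rfl⟩
    exact ⟨UniversalEnvelopingAlgebra.ι ℂ X * x, by simp [← Q.univRep_ι]⟩
  have ha_mem : a ∈ W := ⟨1, by simp⟩
  have htop : W = ⊤ := (Q.eq_bot_or_eq_top_of_drep_mem hW).resolve_left fun hbot =>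
    ha ((Submodule.mem_bot ℂ).1 (hbot ▸ ha_mem))
  exact LinearMap.range_eq_top.1 htop b

end QuarkSystem

section Enveloping

variable {R L : Type*} [CommRing R] [LieRing L] [LieAlgebra R L]

lemma envelopingAlgebra_induction_left {p : UniversalEnvelopingAlgebra R L → Prop} (one : p 1)
    (add : ∀ x y, p x → p y → p (x + y)) (smul : ∀ (c : R) x, p x → p (c • x))
    (ι_mul : ∀ (X : L) x, p x → p (UniversalEnvelopingAlgebra.ι R X * x))
    (x : UniversalEnvelopingAlgebra R L) : p x := by
  have mul_mem (t : TensorAlgebra R L) : ∀ y, p y →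
      p (UniversalEnvelopingAlgebra.mkAlgHom R L t * y) := by
    induction t using TensorAlgebra.induction with
    | algebraMap c => intro y hy; simpa [← Algebra.smul_def] using smul c y hy
    | ι X => intro y hy; exact ι_mul X y hy
    | mul a b ha hb => intro y hy; simpa [mul_assoc] using ha _ (hb y hy)
    | add a b ha hb => intro y hy; simpa [add_mul] using add _ _ (ha y hy) (hb y hy)
  obtain ⟨t, rfl⟩ : ∃ t, UniversalEnvelopingAlgebra.mkAlgHom R L t = x :=
    RingCon.mk'_surjective _ x
  simpa using mul_mem t 1 one

end Enveloping

section PositivePart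

open Polynomial LieAlgebra

lemma map_aeval_apply_of_comp_eq {R M N : Type*} [CommRing R] [AddCommGroup M] [Module R M]
    [AddCommGroup N] [Module R N] {φ : M →ₗ[R] N} {T : Module.End R M} {S : Module.End R N}
    (h : φ ∘ₗ T = S ∘ₗ φ) (p : R[X]) (a : M) : φ (aeval T p a) = aeval S p (φ a) := by
  have hpow (n : ℕ) : φ ((T ^ n) a) = (S ^ n) (φ a) := by
    rw [Module.End.pow_apply, Module.End.pow_apply]
    exact Function.Semiconj.iterate_right (f := φ) (ga := T) (gb := S) (LinearMap.congr_fun h) n a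
  simp only [aeval_eq_sum_range, LinearMap.sum_apply, LinearMap.smul_apply, map_sum, map_smul,
    hpow]

lemma coord_lie (Y Z : Mat3) (m : Fin 8) :
    coord ⁅Y, Z⁆ m = ∑ k, coord Z k * coord ⁅E m, Y⁆ k := by
  have htrace : ⁅E m, Y⁆.trace = 0 := matrix_trace_commutator_zero _ _ _ _
  simp_rw [mul_comm (coord Z _)]
  rw [sum_coord_mul_coord Z htrace, coord_eq, neg_inj]
  simp only [Ring.lie_def, mul_sub, Matrix.trace_sub, ← mul_assoc]
  rw [Matrix.trace_mul_cycle (E m) Y, Matrix.trace_mul_cycle Z Y]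

lemma coord_lie_E (j : Fin 8) (Y : Mat3) (k : Fin 8) :
    coord ⁅E j, Y⁆ k = ∑ l, structConst k j l * coord Y l := by
  rw [coord_lie]
  exact Finset.sum_congr rfl fun l _ => mul_comm _ _

lemma exists_coord_ad_pow_eq_eval (Y : Mat3) (n : ℕ) : ∃ t : Fin 8 → PolySu3,
    ∀ η m, coord ((ad ℂ Mat3 η ^ n) Y) m = MvPolynomial.eval (coord η) (t m) := by
  induction n with
  | zero => exact ⟨fun m => MvPolynomial.C (coord Y m), fun η m => by simp⟩
  | succ n ih =>
    obtain ⟨t, ht⟩ := ih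
    refine ⟨fun m => ∑ k, t k * ∑ l, MvPolynomial.C (structConst k m l) * MvPolynomial.X l,
      fun η m => ?_⟩
    rw [pow_succ', Module.End.mul_apply, ad_apply, coord_lie]
    simp [ht, coord_lie_E]

lemma exists_aeval_ad_eq_sum {Y : Mat3} (hY : Y.trace = 0) (p : ℂ[X]) : ∃ t : Fin 8 → PolySu3,
    ∀ η, aeval (ad ℂ Mat3 η) p Y = ∑ k, MvPolynomial.eval (coord η) (t k) • E k := by
  choose t ht using exists_coord_ad_pow_eq_eval Y
  refine ⟨fun k => ∑ n ∈ Finset.range (p.natDegree + 1), MvPolynomial.C (p.coeff n) * t n k,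
    fun η => ?_⟩
  have htrace : (aeval (ad ℂ Mat3 η) p Y).trace = 0 := by
    have h : Matrix.traceLinearMap (Fin 3) ℂ ℂ ∘ₗ ad ℂ Mat3 η = 0 ∘ₗ Matrix.traceLinearMap _ _ _ :=
      LinearMap.ext fun Z => by simp
    simpa [hY] using map_aeval_apply_of_comp_eq h p Y
  rw [eq_sum_coord_smul_E htrace]
  refine Finset.sum_congr rfl fun k _ => ?_
  simp only [aeval_eq_sum_range, LinearMap.sum_apply, LinearMap.smul_apply, coord_sum, coord_smul,
    ht, map_sum, map_mul, MvPolynomial.eval_C]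

lemma Ad_aeval_ad (g : SU3) (p : ℂ[X]) (η Y : Mat3) :
    Ad g (aeval (ad ℂ Mat3 η) p Y) = aeval (ad ℂ Mat3 (Ad g η)) p (Ad g Y) := by
  simp only [Ad_eq_adAut]
  refine map_aeval_apply_of_comp_eq (φ := (adAut g).toAlgEquiv.toLinearMap)
    (LinearMap.ext fun Z => ?_) p Y
  simp [Ring.lie_def]

lemma aeval_ad_diagWeight_apply (p : ℂ[X]) (d : Fin 3 → ℝ) (Y : Mat3) (a b : Fin 3) :
    aeval (ad ℂ Mat3 (diagWeight d)) p Y a b = p.eval (Complex.I * (d a - d b)) * Y a b := by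
  have h : Matrix.entryLinearMap ℂ ℂ a b ∘ₗ ad ℂ Mat3 (diagWeight d) =
      algebraMap ℂ (Module.End ℂ ℂ) (Complex.I * (d a - d b)) ∘ₗ Matrix.entryLinearMap ℂ ℂ a b :=
    LinearMap.ext fun Z => by
      simp [diagWeight_apply, Ring.lie_def]
      ring
  refine (map_aeval_apply_of_comp_eq h p Y).trans ?_
  rw [aeval_algebraMap_apply, coe_aeval_eq_eval]
  rfl

lemma exists_eval_eq_ite_lt {ι : Type*} [Finite ι] (d : ι → ℝ) : ∃ p : ℂ[X], ∀ a b,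
    p.eval (Complex.I * (d a - d b)) = if d b < d a then 1 else 0 := by
  classical
  have := Fintype.ofFinite ι
  let nodes : Finset ℂ :=
    Finset.univ.image fun ab : ι × ι => Complex.I * (d ab.1 - d ab.2)
  refine ⟨Lagrange.interpolate nodes id fun z => if 0 < z.im then 1 else 0, fun a b => ?_⟩
  have hnode : Complex.I * (d a - d b) ∈ nodes :=
    Finset.mem_image.2 ⟨(a, b), Finset.mem_univ _, rfl⟩
  refine (Lagrange.eval_interpolate_at_node _ Function.injective_id.injOn hnode).trans ?_
  simp

end PositivePart

section HighestWeightVector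

open LieAlgebra.SpecialLinear

lemma eq_diagonal_add_sum_single {X D : sl3}
    (hD : (D : Mat3) = Matrix.diagonal fun a => (X : Mat3) a a) :
    X = D + ∑ a, ∑ b, if h : a = b then 0 else single a b h ((X : Mat3) a b) := by
  ext i j
  fin_cases i <;> fin_cases j <;> simp [hD, Fin.sum_univ_three]

lemma lie_adj_single {a b : Fin 3} (hab : a ≠ b) (c : ℂ) :
    ((⁅adj (single a b hab c), single a b hab c⁆ : sl3) : Mat3) =
      Matrix.diagonal (Pi.single b (star c * c) - Pi.single a (c * star c)) := by
  rw [LieSubalgebra.coe_bracket, Ring.lie_def, coe_adj, val_single, Matrix.conjTranspose_single,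
    Matrix.single_mul_single_same, Matrix.single_mul_single_same, ← Matrix.diagonal_single,
    ← Matrix.diagonal_single, Matrix.diagonal_sub]
  rfl

lemma AdSl_AdSl_inv (g : SU3) (X : sl3) : AdSl g (AdSl g⁻¹ X) = X :=
  Subtype.ext (by simpa using Ad_inv_Ad g⁻¹ (X : Mat3))

lemma adj_adj (X : sl3) : adj (adj X) = X := Subtype.ext (by simp)

lemma adj_AdSl (g : SU3) (X : sl3) : adj (AdSl g X) = AdSl g (adj X) :=
  Subtype.ext <| by
    rw [coe_adj, coe_AdSl, coe_AdSl, coe_adj, Ad_eq_adAut, Ad_eq_adAut,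
      ← Matrix.star_eq_conjTranspose, ← Matrix.star_eq_conjTranspose, map_star]

namespace QuarkSystem

variable {ω : Mat3} (Q : QuarkSystem.{u} ω)

lemma inner_drep_hwVec_self {X : sl3} (hX : Q.drep (adj X) Q.hwVec = 0) :
    ⟪Q.drep X Q.hwVec, Q.drep X Q.hwVec⟫_ℂ = ⟪Q.hwVec, Q.drep ⁅adj X, X⁆ Q.hwVec⟫_ℂ := by
  rw [LieHom.map_lie, Ring.lie_def, LinearMap.sub_apply, Module.End.mul_apply,
    Module.End.mul_apply, hX, map_zero, sub_zero, ← Q.inner_drep_adj (adj X), adj_adj]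

variable {d : Fin 3 → ℝ} (Q : QuarkSystem.{u} (diagWeight d))

lemma drep_hwVec_of_isDiag {X : sl3} (hX : (X : Mat3).IsDiag) :
    Q.drep X Q.hwVec = (∑ a, (X : Mat3) a a * (d a : ℂ)) • Q.hwVec := by
  rw [Q.drep_diag X hX, trace_mul_neg_I_smul_diagWeight]

lemma drep_single_hwVec {a b : Fin 3} (hba : b < a) (hd : d a = d b) (c : ℂ) :
    Q.drep (single a b hba.ne' c) Q.hwVec = 0 := by
  have hupper : Q.drep (adj (single a b hba.ne' c)) Q.hwVec = 0 := by
    refine Q.drep_upper _ fun i j hij => ?_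
    rw [coe_adj, val_single, Matrix.conjTranspose_apply, Matrix.single_apply, if_neg, star_zero]
    rintro ⟨rfl, rfl⟩
    exact hba.not_ge hij
  have hlie := lie_adj_single hba.ne' c
  have hdiag : Q.drep ⁅adj (single a b hba.ne' c), single a b hba.ne' c⁆ Q.hwVec = 0 := by
    rw [Q.drep_hwVec_of_isDiag (hlie ▸ Matrix.isDiag_diagonal _), hlie]
    simp [Pi.single_apply, sub_mul, Finset.sum_sub_distrib, hd, mul_comm c, sub_self]
  rw [← inner_self_eq_zero (𝕜 := ℂ), Q.inner_drep_hwVec_self hupper, hdiag, inner_zero_right]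

lemma drep_hwVec_of_parabolic (hd : Antitone d) {X : sl3}
    (hX : ∀ a b, d a < d b → (X : Mat3) a b = 0) :
    Q.drep X Q.hwVec = (∑ a, (X : Mat3) a a * (d a : ℂ)) • Q.hwVec := by
  let D : sl3 := ⟨Matrix.diagonal fun a => (X : Mat3) a a, LinearMap.mem_ker.2
    ((Matrix.trace_diagonal _).trans (trace_sl3 X))⟩
  have hD : Q.drep D Q.hwVec = (∑ a, (X : Mat3) a a * (d a : ℂ)) • Q.hwVec := by
    rw [Q.drep_hwVec_of_isDiag (Matrix.isDiag_diagonal _)]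
    simp [D]
  have hoff (a b : Fin 3) (hab : a ≠ b) :
      Q.drep (single a b hab ((X : Mat3) a b)) Q.hwVec = 0 := by
    obtain hlt | hba := hab.lt_or_gt
    · refine Q.drep_upper _ fun i j hij => ?_
      rw [val_single, Matrix.single_apply, if_neg]
      rintro ⟨rfl, rfl⟩
      exact hlt.not_ge hij
    obtain hlt | heq := (hd hba.le).lt_or_eq
    · rw [hX a b hlt, map_zero, map_zero, LinearMap.zero_apply]
    · exact Q.drep_single_hwVec hba heq _
  conv_lhs => rw [eq_diagonal_add_sum_single (X := X) (D := D) rfl]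
  simp only [map_add, map_sum, LinearMap.add_apply, LinearMap.sum_apply, hD, add_eq_left]
  refine Finset.sum_eq_zero fun a _ => Finset.sum_eq_zero fun b _ => ?_
  split_ifs with hab
  · rw [map_zero, LinearMap.zero_apply]
  · exact hoff a b hab

end QuarkSystem

end HighestWeightVector

section Symbol

namespace QuarkSystem

variable {ω : Mat3} (Q : QuarkSystem.{u} ω)

/-- The covariant symbol `A ↦ tr(A Π_>^g)` at `Ad_g(ξ)`, written as the expectation of `A` in the
coherent state `g · hwVec`. -/
def symbol (g : SU3) : Module.End ℂ Q.H →ₗ[ℂ] ℂ where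
  toFun A := ⟪Q.rep g Q.hwVec, A (Q.rep g Q.hwVec)⟫_ℂ
  map_add' A B := by simp
  map_smul' c A := by simp

lemma symbol_apply (g : SU3) (A : Module.End ℂ Q.H) :
    Q.symbol g A = ⟪Q.rep g Q.hwVec, A (Q.rep g Q.hwVec)⟫_ℂ := rfl

lemma norm_rep_hwVec (g : SU3) : ‖Q.rep g Q.hwVec‖ = 1 := by
  rw [LinearIsometryEquiv.norm_map, Q.norm_hwVec]

lemma symbol_one (g : SU3) : Q.symbol g 1 = 1 := by
  rw [symbol_apply, Module.End.one_apply, inner_self_eq_norm_sq_to_K, norm_rep_hwVec]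
  simp

lemma hwProjAt_apply (g : SU3) (a : Q.H) :
    Q.hwProjAt g a = ⟪Q.rep g Q.hwVec, a⟫_ℂ • Q.rep g Q.hwVec :=
  calc Q.hwProjAt g a
      = Q.rep g ((ℂ ∙ Q.hwVec).starProjection (Q.rep g⁻¹ a)) := rfl
    _ = ⟪Q.hwVec, Q.rep g⁻¹ a⟫_ℂ • Q.rep g Q.hwVec := by
      rw [Submodule.starProjection_unit_singleton ℂ Q.norm_hwVec, map_smul]
    _ = ⟪Q.rep g Q.hwVec, a⟫_ℂ • Q.rep g Q.hwVec := by rw [← Q.inner_rep g, rep_rep_inv]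

lemma trace_mul_hwProjAt (A : Module.End ℂ Q.H) (g : SU3) :
    LinearMap.trace ℂ Q.H (A * Q.hwProjAt g) = Q.symbol g A := by
  have hrankOne : A * Q.hwProjAt g =
      (InnerProductSpace.rankOne ℂ (A (Q.rep g Q.hwVec)) (Q.rep g Q.hwVec)).toLinearMap := by
    ext a
    simp [hwProjAt_apply]
  rw [hrankOne, InnerProductSpace.trace_rankOne, symbol_apply]

lemma drep_rep (X : sl3) (g : SU3) (a : Q.H) :
    Q.drep X (Q.rep g a) = Q.rep g (Q.drep (AdSl g⁻¹ X) a) := by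
  rw [rep_drep, AdSl_AdSl_inv]

variable {d : Fin 3 → ℝ} (Q : QuarkSystem.{u} (diagWeight d))

lemma drep_rep_hwVec_eq_zero (hd : Antitone d) {g : SU3} {Z : sl3}
    (hZ : ∀ a b, d a ≤ d b → Ad g⁻¹ Z a b = 0) : Q.drep Z (Q.rep g Q.hwVec) = 0 := by
  have hupper : Q.drep (AdSl g⁻¹ Z) Q.hwVec = 0 := Q.drep_upper _ fun i j hij => by
    rw [coe_AdSl, hZ i j (hd hij)]
  rw [drep_rep, hupper, map_zero]

lemma drep_adj_rep_hwVec (hd : Antitone d) {g : SU3} {Y : sl3}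
    (hY : ∀ a b, d b < d a → Ad g⁻¹ Y a b = 0) :
    Q.drep (adj Y) (Q.rep g Q.hwVec) =
      star (∑ a, Ad g⁻¹ Y a a * (d a : ℂ)) • Q.rep g Q.hwVec := by
  have hentry (a b : Fin 3) : (AdSl g⁻¹ (adj Y) : Mat3) a b = star (Ad g⁻¹ Y b a) := by
    rw [← adj_AdSl, coe_adj, Matrix.conjTranspose_apply, coe_AdSl]
  have hparabolic (a b : Fin 3) (hab : d a < d b) : (AdSl g⁻¹ (adj Y) : Mat3) a b = 0 := by
    rw [hentry, hY b a hab, star_zero]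
  rw [drep_rep, Q.drep_hwVec_of_parabolic hd hparabolic, map_smul]
  simp [hentry]

lemma sum_Ad_inv_apply_mul (X : Mat3) (g : SU3) (d : Fin 3 → ℝ) :
    ∑ a, Ad g⁻¹ X a a * (d a : ℂ) = -Complex.I * (X * Ad g (diagWeight d)).trace := by
  have hconj : Ad g⁻¹ (X * Ad g (diagWeight d)) = Ad g⁻¹ X * diagWeight d := by
    rw [Ad_eq_adAut, map_mul, ← Ad_eq_adAut, ← Ad_eq_adAut, Ad_inv_Ad]
  rw [← trace_mul_neg_I_smul_diagWeight, Matrix.mul_smul, Matrix.trace_smul, smul_eq_mul, ← hconj,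
    trace_Ad]

lemma symbol_drep_mul (hd : Antitone d) {g : SU3} {X Z : sl3}
    (hZ : ∀ a b, Ad g⁻¹ Z a b = if d b < d a then Ad g⁻¹ X a b else 0) (A : Module.End ℂ Q.H) :
    Q.symbol g (Q.drep X * A) =
      -Complex.I * ((X : Mat3) * Ad g (diagWeight d)).trace * Q.symbol g A +
        Q.symbol g ⁅Q.drep Z, A⁆ := by
  have hdiff (a b : Fin 3) :
      Ad g⁻¹ (X - Z : sl3) a b = if d b < d a then 0 else Ad g⁻¹ X a b := by
    rw [← coe_AdSl, map_sub, AddSubgroupClass.coe_sub, Matrix.sub_apply, coe_AdSl, coe_AdSl, hZ]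
    split_ifs <;> simp
  have hparabolic : Q.symbol g (Q.drep (X - Z) * A) =
      -Complex.I * ((X : Mat3) * Ad g (diagWeight d)).trace * Q.symbol g A := by
    rw [symbol_apply, Module.End.mul_apply, ← inner_drep_adj,
      Q.drep_adj_rep_hwVec hd fun a b hab => (hdiff a b).trans (if_pos hab), inner_smul_left,
      starRingEnd_apply, star_star, ← sum_Ad_inv_apply_mul, symbol_apply]
    simp only [hdiff, lt_irrefl, if_false]
  have hraising : Q.symbol g (Q.drep Z * A) = Q.symbol g ⁅Q.drep Z, A⁆ := by
    rw [Ring.lie_def, map_sub, Q.symbol_apply g (A * _), Module.End.mul_apply,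
      Q.drep_rep_hwVec_eq_zero hd fun a b hab => (hZ a b).trans (if_neg hab.not_gt), map_zero,
      inner_zero_right, sub_zero]
  rw [← hparabolic, ← hraising, ← map_add, ← add_mul, ← map_add, sub_add_cancel]

end QuarkSystem

-- The raising part `Z` of `X` at `η = Ad g (diagWeight d)` is a polynomial in `ad η` applied to
-- `X`, so its coordinates are polynomials in those of `η`.
lemma exists_symbol_drep_mul {d : Fin 3 → ℝ} (hd : Antitone d) (X : sl3) :
    ∃ t : Fin 8 → PolySu3, ∀ (c : ℝ), 0 < c → ∀ (Q : QuarkSystem.{u} (diagWeight (c • d)))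
      (A : Module.End ℂ Q.H) (g : SU3), Q.symbol g (Q.drep X * A) =
        -Complex.I * c * ((X : Mat3) * Ad g (diagWeight d)).trace * Q.symbol g A +
        ∑ k, MvPolynomial.eval (coord (Ad g (diagWeight d))) (t k) *
          Q.symbol g ⁅Q.drep (Esu k), A⁆ := by
  obtain ⟨p, hp⟩ := exists_eval_eq_ite_lt d
  obtain ⟨t, ht⟩ := exists_aeval_ad_eq_sum (trace_sl3 X) p
  refine ⟨t, fun c hc Q A g => ?_⟩
  set η := Ad g (diagWeight d) with hη
  let Z : sl3 := ∑ k, MvPolynomial.eval (coord η) (t k) • (Esu k : sl3)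
  have hZ : (Z : Mat3) = Polynomial.aeval (LieAlgebra.ad ℂ Mat3 η) p (X : Mat3) := by
    rw [ht η]
    simp [Z]
  have hpos (a b : Fin 3) :
      Ad g⁻¹ Z a b = if (c • d) b < (c • d) a then Ad g⁻¹ X a b else 0 := by
    rw [hZ, Ad_aeval_ad, hη, Ad_inv_Ad, aeval_ad_diagWeight_apply, hp]
    simp only [Pi.smul_apply, smul_eq_mul, mul_lt_mul_iff_right₀ hc, ite_mul, one_mul, zero_mul]
  have hscale : ((X : Mat3) * Ad g (diagWeight (c • d))).trace = c * ((X : Mat3) * η).trace := by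
    rw [map_smul, ← Complex.coe_smul, Ad_eq_adAut, map_smul, ← Ad_eq_adAut, Matrix.mul_smul,
      Matrix.trace_smul, smul_eq_mul]
  rw [Q.symbol_drep_mul (hd.const_smul hc.le) hpos, hscale]
  simp [Z, sum_lie, mul_assoc]

end Symbol

section Derivative

lemma oneParam_inv (X : su3) (t : ℝ) : (oneParam X t)⁻¹ = oneParam X (-t) :=
  inv_eq_of_mul_eq_one_right (by rw [← oneParam_add, add_neg_cancel, oneParam_zero])

open scoped Matrix.Norms.L2Operator in
lemma hasDerivAt_coord_Ad_oneParam (X : su3) (η : Mat3) (k : Fin 8) :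
    HasDerivAt (fun t : ℝ => coord (Ad (oneParam X t) η) k) (coord ⁅(X : Mat3), η⁆ k) 0 := by
  have hexp (Y : Mat3) : HasDerivAt (fun t : ℝ => NormedSpace.exp (t • Y)) Y 0 := by
    simpa using hasDerivAt_exp_smul_const (𝕂 := ℝ) Y (0 : ℝ)
  have hAd (t : ℝ) : Ad (oneParam X t) η =
      NormedSpace.exp (t • (X : Mat3)) * η * NormedSpace.exp (t • -(X : Mat3)) := by
    rw [Ad, oneParam_inv, coe_oneParam, coe_oneParam, neg_smul, smul_neg]
  have hconj : HasDerivAt (fun t : ℝ =>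
      NormedSpace.exp (t • (X : Mat3)) * η * NormedSpace.exp (t • -(X : Mat3)))
      ⁅(X : Mat3), η⁆ 0 :=
    (((hexp X).mul_const η).fun_mul (hexp (-X))).congr_deriv
      (by simp [Ring.lie_def, sub_eq_add_neg])
  let coordMap : Mat3 →ₗ[ℝ] ℂ :=
    Matrix.traceLinearMap (Fin 3) ℝ ℂ ∘ₗ LinearMap.mulLeft ℝ (E k)ᴴ
  simp only [hAd]
  exact coordMap.toContinuousLinearMap.hasFDerivAt.comp_hasDerivAt (0 : ℝ) hconj

lemma hasDerivAt_eval {σ : Type*} [Fintype σ] {x : ℝ → σ → ℂ} {x' : σ → ℂ} {t : ℝ}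
    (hx : ∀ k, HasDerivAt (fun t => x t k) (x' k) t) (P : MvPolynomial σ ℂ) :
    HasDerivAt (fun t => MvPolynomial.eval (x t) P)
      (∑ k, MvPolynomial.eval (x t) (MvPolynomial.pderiv k P) * x' k) t := by
  classical
  induction P using MvPolynomial.induction_on with
  | C c => simpa using hasDerivAt_const t c
  | add P R hP hR =>
    simp only [map_add, add_mul, Finset.sum_add_distrib]
    exact hP.add hR
  | mul_X P j hP =>
    simp only [map_mul, MvPolynomial.eval_X]
    refine (hP.fun_mul (hx j)).congr_deriv ?_
    simp only [Derivation.leibniz, MvPolynomial.pderiv_X, smul_eq_mul, map_add, map_mul,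
      MvPolynomial.eval_X, add_mul, Finset.sum_add_distrib, Finset.sum_mul]
    simp [Pi.single_apply, apply_ite, mul_right_comm, mul_comm (x t j), add_comm]

lemma eval_poissonBracket_X (j : Fin 8) (P : PolySu3) (η : Mat3) :
    MvPolynomial.eval (coord η) (poissonBracket (MvPolynomial.X j) P) =
      ∑ k, MvPolynomial.eval (coord η) (MvPolynomial.pderiv k P) * coord ⁅E j, η⁆ k := by
  simp only [poissonBracket, map_sum, map_mul, MvPolynomial.eval_C, MvPolynomial.eval_X,
    coord_lie_E, Finset.mul_sum]
  rw [Finset.sum_eq_single j (fun i _ hi => by simp [MvPolynomial.pderiv_X_of_ne hi.symm])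
    (by simp)]
  refine Finset.sum_congr rfl fun k _ => Finset.sum_congr rfl fun l _ => ?_
  rw [MvPolynomial.pderiv_X_self, map_one, one_mul, mul_comm]

end Derivative

section HasSymbol

namespace QuarkSystem

variable {ω : Mat3} (Q : QuarkSystem.{u} ω)

/-- The operator `A` has the restriction of the polynomial `P` as its symbol on the orbit of `ξ`. -/
def HasSymbol (ξ : Mat3) (A : Module.End ℂ Q.H) (P : PolySu3) : Prop :=
  ∀ g : SU3, Q.symbol g A = MvPolynomial.eval (coord (Ad g ξ)) P

variable {Q}

lemma hasSymbol_one (ξ : Mat3) : Q.HasSymbol ξ 1 1 := fun g => by rw [symbol_one, map_one]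

lemma HasSymbol.add {ξ : Mat3} {A B : Module.End ℂ Q.H} {P R : PolySu3} (hA : Q.HasSymbol ξ A P)
    (hB : Q.HasSymbol ξ B R) : Q.HasSymbol ξ (A + B) (P + R) :=
  fun g => by rw [map_add, map_add, hA, hB]

lemma HasSymbol.smul {ξ : Mat3} {A : Module.End ℂ Q.H} {P : PolySu3} (hA : Q.HasSymbol ξ A P)
    (a : ℂ) : Q.HasSymbol ξ (a • A) (a • P) :=
  fun g => by rw [map_smul, hA, MvPolynomial.smul_eval, smul_eq_mul]

-- Both sides are the derivative at `0` of the symbol of `A` along `t ↦ exp(tE_j) g`.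
lemma HasSymbol.lie {ξ : Mat3} {A : Module.End ℂ Q.H} {P : PolySu3} (h : Q.HasSymbol ξ A P)
    (j : Fin 8) :
    Q.HasSymbol ξ ⁅Q.drep (Esu j), A⁆ (-poissonBracket (MvPolynomial.X j) P) := by
  intro g
  set v := Q.rep g Q.hwVec with hv
  have hvec := Q.hasDerivAt_rep_oneParam_zero (Esu j) v
  have hoperator : HasDerivAt (fun t => A (Q.rep (oneParam (Esu j) t) v))
      (A (Q.drep (Esu j) v)) 0 :=
    ((LinearMap.toContinuousLinearMap A).restrictScalars ℝ).hasFDerivAt.comp_hasDerivAt (0 : ℝ) hvec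
  have hpoly := hasDerivAt_eval (fun k => hasDerivAt_coord_Ad_oneParam (Esu j) (Ad g ξ) k) P
  have hagree (t : ℝ) : ⟪Q.rep (oneParam (Esu j) t) v, A (Q.rep (oneParam (Esu j) t) v)⟫_ℂ =
      MvPolynomial.eval (coord (Ad (oneParam (Esu j) t) (Ad g ξ))) P := by
    rw [hv, ← rep_mul_apply, ← symbol_apply, h]
    simp only [Ad_eq_adAut, map_mul, StarAlgEquiv.mul_apply]
  have hderiv := (hvec.inner ℂ hoperator).unique
    (hpoly.congr_of_eventuallyEq (.of_forall hagree))
  simp only [oneParam_zero, Ad_one, rep_one_apply, Q.inner_drep_of_skew, coe_Esu] at hderiv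
  rw [map_neg, eval_poissonBracket_X, ← hderiv, symbol_apply, ← hv, Ring.lie_def,
    LinearMap.sub_apply, Module.End.mul_apply, Module.End.mul_apply, inner_sub_right]
  ring

variable {d : Fin 3 → ℝ} {c : ℝ} (Q : QuarkSystem.{u} (diagWeight (c • d)))

lemma exists_hasSymbol_drep_mul (hd : Antitone d) (hc : 0 < c) (X : sl3) :
    ∃ T : PolySu3 → PolySu3, T 0 = 0 ∧ ∀ A P,
      Q.HasSymbol (diagWeight d) A P → Q.HasSymbol (diagWeight d) (Q.drep X * A) (T P) := by
  obtain ⟨t, ht⟩ := exists_symbol_drep_mul hd X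
  refine ⟨fun P => MvPolynomial.C (Complex.I * c) *
      (∑ l, MvPolynomial.C (coord X l) * MvPolynomial.X l) * P +
      ∑ k, t k * -poissonBracket (MvPolynomial.X k) P, by simp [poissonBracket], fun A P h g => ?_⟩
  have hlie (k : Fin 8) := h.lie k g
  rw [ht c hc Q A g, h g]
  simp only [hlie, map_add, map_mul, map_sum, MvPolynomial.eval_C, MvPolynomial.eval_X]
  rw [sum_coord_mul_coord _ (trace_sl3 X), Matrix.trace_mul_comm]
  ring

lemma exists_hasSymbol (hd : Antitone d) (hc : 0 < c) (x : Usl3) :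
    ∃ P : PolySu3, Q.HasSymbol (diagWeight d) (Q.univRep x) P := by
  induction x using envelopingAlgebra_induction_left with
  | one => exact ⟨1, by rw [map_one]; exact hasSymbol_one _⟩
  | add x y hx hy =>
    obtain ⟨P, hP⟩ := hx
    obtain ⟨R, hR⟩ := hy
    exact ⟨P + R, by rw [map_add]; exact hP.add hR⟩
  | smul a x hx =>
    obtain ⟨P, hP⟩ := hx
    exact ⟨a • P, by rw [map_smul Q.univRep]; exact hP.smul a⟩
  | ι_mul X x hx =>
    obtain ⟨P, hP⟩ := hx
    obtain ⟨T, -, hT⟩ := Q.exists_hasSymbol_drep_mul hd hc X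
    exact ⟨T P, by rw [map_mul, univRep_ι]; exact hT _ P hP⟩

lemma HasSymbol.univRep_mul {Q : QuarkSystem.{u} (diagWeight (c • d))} (hd : Antitone d)
    (hc : 0 < c) {A : Module.End ℂ Q.H} (hA : Q.HasSymbol (diagWeight d) A 0) (x : Usl3) :
    Q.HasSymbol (diagWeight d) (Q.univRep x * A) 0 := by
  induction x using envelopingAlgebra_induction_left with
  | one => rwa [map_one, one_mul]
  | add x y hx hy =>
    rw [map_add, add_mul, ← add_zero 0]
    exact hx.add hy
  | smul a x hx =>
    rw [map_smul Q.univRep, smul_mul_assoc, ← smul_zero a]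
    exact hx.smul a
  | ι_mul X x hx =>
    obtain ⟨T, hT0, hT⟩ := Q.exists_hasSymbol_drep_mul hd hc X
    rw [map_mul, mul_assoc, univRep_ι, ← hT0]
    exact hT _ 0 hx

end QuarkSystem

end HasSymbol

section Irreducibility

namespace QuarkSystem

variable {ω : Mat3} (Q : QuarkSystem.{u} ω)

lemma hwVec_ne_zero : Q.hwVec ≠ 0 := norm_ne_zero_iff.1 (Q.norm_hwVec ▸ one_ne_zero)

lemma span_rep_hwVec : Submodule.span ℂ (Set.range fun g => Q.rep g Q.hwVec) = ⊤ := by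
  set W := Submodule.span ℂ (Set.range fun g => Q.rep g Q.hwVec)
  have hinvariant (g : SU3) : W ≤ W.comap (Q.op g) := by
    refine Submodule.span_le.2 ?_
    rintro _ ⟨h, rfl⟩
    exact Submodule.subset_span ⟨g * h, Q.rep_mul_apply g h _⟩
  refine (Q.irreducible W hinvariant).resolve_left fun hbot => Q.hwVec_ne_zero ?_
  rw [← Submodule.mem_bot ℂ, ← hbot]
  exact Submodule.subset_span ⟨1, Q.rep_one_apply _⟩

-- If `A (g · hwVec) ≠ 0`, some `univRep x` sends it to `g · hwVec`, so that `univRep x * A` has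
-- symbol `1` at `g`.
lemma eq_zero_of_hasSymbol_zero {d : Fin 3 → ℝ} {c : ℝ} {Q : QuarkSystem.{u} (diagWeight (c • d))}
    (hd : Antitone d) (hc : 0 < c) {A : Module.End ℂ Q.H} (hA : Q.HasSymbol (diagWeight d) A 0) :
    A = 0 := by
  refine LinearMap.ext_on_range Q.span_rep_hwVec fun g => ?_
  by_contra hne
  obtain ⟨x, hx⟩ := Q.exists_univRep_apply_eq hne (Q.rep g Q.hwVec)
  have hzero : Q.symbol g (Q.univRep x * A) = 0 := by rw [hA.univRep_mul hd hc x g, map_zero]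
  have hone : Q.symbol g (Q.univRep x * A) = Q.symbol g 1 := by
    rw [symbol_apply, Module.End.mul_apply, hx, symbol_apply, Module.End.one_apply]
  exact one_ne_zero (((Q.symbol_one g).symm.trans hone.symm).trans hzero)

end QuarkSystem

/-- **Burnside's theorem** on irreducible algebras of operators. -/
lemma subalgebra_eq_top_of_isSimpleModule {k V : Type*} [Field k] [IsAlgClosed k] [AddCommGroup V]
    [Module k V] [FiniteDimensional k V] (S : Subalgebra k (Module.End k V)) [IsSimpleModule S V] :
    S = ⊤ := by
  have hfinite : Module.Finite (Module.End S V) V := .of_restrictScalars_finite k _ _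
  refine eq_top_iff.2 fun f _ => ?_
  let f' : Module.End (Module.End S V) V :=
    { toFun := f
      map_add' := map_add f
      map_smul' := fun e a => by
        obtain ⟨c, rfl⟩ := (IsSimpleModule.algebraMap_end_bijective_of_isAlgClosed k).2 e
        simp }
  obtain ⟨r, hr⟩ := Module.Finite.toModuleEnd_moduleEnd_surjective f'
  have hfr : f = (r : Module.End k V) := LinearMap.ext fun a => (LinearMap.congr_fun hr a).symm
  exact hfr ▸ r.2

lemma QuarkSystem.univRep_surjective {ω : Mat3} (Q : QuarkSystem.{u} ω) :
    Function.Surjective Q.univRep := by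
  have hsimple : IsSimpleModule Q.univRep.range Q.H := by
    refine isSimpleModule_iff_toSpanSingleton_surjective.2
      ⟨⟨Q.hwVec, 0, Q.hwVec_ne_zero⟩, fun a ha b => ?_⟩
    obtain ⟨x, hx⟩ := Q.exists_univRep_apply_eq ha b
    exact ⟨⟨_, x, rfl⟩, hx⟩
  rw [← AlgHom.range_eq_top]
  exact subalgebra_eq_top_of_isSimpleModule _

end Irreducibility

section Filtration

lemma lie_mem_pow_of_lie_mem {R A : Type*} [CommRing R] [Ring A] [Algebra R A] {V : Submodule R A}
    (hV : ∀ a ∈ V, ∀ b ∈ V, ⁅a, b⁆ ∈ V) {a : A} (ha : a ∈ V) {n : ℕ} {x : A} (hx : x ∈ V ^ n) :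
    ⁅a, x⁆ ∈ V ^ n := by
  induction n generalizing x with
  | zero =>
    rw [pow_zero, Submodule.mem_one] at hx
    obtain ⟨c, rfl⟩ := hx
    rw [Ring.lie_def, Algebra.commutes, sub_self]
    exact Submodule.zero_mem _
  | succ n ih =>
    rw [pow_succ'] at hx ⊢
    induction hx using Submodule.mul_induction_on' with
    | mem_mul_mem b hb x hx =>
      have hleibniz : ⁅a, b * x⁆ = ⁅a, b⁆ * x + b * ⁅a, x⁆ := by
        simp only [Ring.lie_def]
        noncomm_ring
      rw [hleibniz]
      exact Submodule.add_mem _ (Submodule.mul_mem_mul (hV a ha b hb) hx)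
        (Submodule.mul_mem_mul hb (ih hx))
    | add x _ y _ hx hy =>
      rw [lie_add]
      exact Submodule.add_mem _ hx hy

open UniversalEnvelopingAlgebra

variable {R L : Type*} [CommRing R] [LieRing L] [LieAlgebra R L]

/-- The image of the Lie algebra `L` in its universal enveloping algebra. -/
abbrev generators (R L : Type*) [CommRing R] [LieRing L] [LieAlgebra R L] :
    Submodule R (UniversalEnvelopingAlgebra R L) :=
  LinearMap.range (ι R : L →ₗ⁅R⁆ UniversalEnvelopingAlgebra R L).toLinearMap

lemma lie_ι_mem_generators_pow (X : L) {n : ℕ} {x : UniversalEnvelopingAlgebra R L}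
    (hx : x ∈ generators R L ^ n) : ⁅ι R X, x⁆ ∈ generators R L ^ n := by
  refine lie_mem_pow_of_lie_mem ?_ (LinearMap.mem_range_self _ X) hx
  rintro _ ⟨Y, rfl⟩ _ ⟨Z, rfl⟩
  exact ⟨⁅Y, Z⁆, LieHom.map_lie _ Y Z⟩

lemma iSup_generators_pow : ⨆ n : ℕ, generators R L ^ n = ⊤ := by
  refine eq_top_iff.2 fun x _ => ?_
  induction x using envelopingAlgebra_induction_left with
  | one =>
    refine Submodule.mem_iSup_of_mem 0 ?_
    rw [pow_zero]
    exact Submodule.one_le.1 le_rfl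
  | add x y hx hy => exact Submodule.add_mem _ (hx trivial) (hy trivial)
  | smul c x hx => exact Submodule.smul_mem _ c (hx trivial)
  | ι_mul X x hx =>
    have hmul : ι R X * x ∈ generators R L * ⨆ n : ℕ, generators R L ^ n :=
      Submodule.mul_mem_mul ⟨X, rfl⟩ (hx trivial)
    simp_rw [Submodule.mul_iSup, ← pow_succ'] at hmul
    have hle : ⨆ n : ℕ, generators R L ^ (n + 1) ≤ ⨆ n : ℕ, generators R L ^ n :=
      iSup_le fun n => le_iSup (generators R L ^ ·) (n + 1)
    exact hle hmul

end Filtration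

section HighestWeightModules

open UniversalEnvelopingAlgebra

variable {H : Type*} [NormedAddCommGroup H] [InnerProductSpace ℂ H]

/-- A star representation `τ` of `𝔰𝔩(3)` with a unit vector `v` on which every upper triangular
matrix `X` acts by the weight `∑ a, X a a * d a`. -/
structure IsHighestWeight (τ : sl3 →ₗ⁅ℂ⁆ Module.End ℂ H) (v : H) (d : Fin 3 → ℝ) : Prop where
  inner_adj : ∀ X a b, ⟪τ (adj X) a, b⟫_ℂ = ⟪a, τ X b⟫_ℂ
  norm_eq_one : ‖v‖ = 1
  apply_of_upper : ∀ X : sl3, (X : Mat3).IsUpperTriangular →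
    τ X v = (∑ a, (X : Mat3) a a * (d a : ℂ)) • v

lemma QuarkSystem.isHighestWeight {d : Fin 3 → ℝ} (Q : QuarkSystem.{u} (diagWeight d))
    (hd : Antitone d) : IsHighestWeight Q.drep Q.hwVec d where
  inner_adj := Q.inner_drep_adj
  norm_eq_one := Q.norm_hwVec
  apply_of_upper _ hX := Q.drep_hwVec_of_parabolic hd fun _ _ hlt => hX (hd.reflect_lt hlt)

/-- The strictly upper triangular part of a matrix. -/
def strictUpper (X : sl3) : sl3 :=
  ⟨Matrix.of fun i j => if i < j then (X : Mat3) i j else 0,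
    LinearMap.mem_ker.2 (by simp [Matrix.trace])⟩

lemma strictUpper_apply (X : sl3) (i j : Fin 3) :
    (strictUpper X : Mat3) i j = if i < j then (X : Mat3) i j else 0 := rfl

namespace IsHighestWeight

variable {K : Type*} [NormedAddCommGroup K] [InnerProductSpace ℂ K]
  {τ : sl3 →ₗ⁅ℂ⁆ Module.End ℂ H} {v : H} {σ : sl3 →ₗ⁅ℂ⁆ Module.End ℂ K} {w : K} {d : Fin 3 → ℝ}

lemma apply_strictUpper (h : IsHighestWeight τ v d) (X : sl3) : τ (strictUpper X) v = 0 := by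
  rw [h.apply_of_upper]
  · simp [strictUpper_apply]
  · intro i j hij
    exact if_neg (lt_asymm hij)

lemma inner_apply_of_lower (h : IsHighestWeight τ v d) {X : sl3}
    (hX : ∀ i j, i < j → (X : Mat3) i j = 0) (a : H) :
    ⟪v, τ X a⟫_ℂ = (∑ a, (X : Mat3) a a * (d a : ℂ)) * ⟪v, a⟫_ℂ := by
  rw [← h.inner_adj, h.apply_of_upper, inner_smul_left]
  · simp [Matrix.conjTranspose_apply]
  · intro i j hij
    rw [coe_adj, Matrix.conjTranspose_apply, hX j i hij, star_zero]

lemma inner_lift_ι_mul (h : IsHighestWeight τ v d) (X : sl3) (x : Usl3) :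
    ⟪v, lift ℂ τ (ι ℂ X * x) v⟫_ℂ = (∑ a, (X : Mat3) a a * (d a : ℂ)) * ⟪v, lift ℂ τ x v⟫_ℂ +
      ⟪v, lift ℂ τ ⁅ι ℂ (strictUpper X), x⁆ v⟫_ℂ := by
  have hdecomp : ι ℂ X * x = ι ℂ (X - strictUpper X) * x +
      (⁅ι ℂ (strictUpper X), x⁆ + x * ι ℂ (strictUpper X)) := by
    rw [Ring.lie_def, map_sub]
    noncomm_ring
  have hlower := h.inner_apply_of_lower (X := X - strictUpper X)
    (fun i j hij => by simp [strictUpper_apply, hij]) (lift ℂ τ x v)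
  rw [hdecomp, map_add, map_add, map_mul, map_mul (lift ℂ τ) x, lift_ι_apply, lift_ι_apply,
    LinearMap.add_apply, LinearMap.add_apply, Module.End.mul_apply, Module.End.mul_apply,
    h.apply_strictUpper, map_zero, add_zero, inner_add_right, hlower]
  simp [strictUpper_apply]

-- Commuting the raising part of the leftmost factor of a product to the right, where it kills `v`,
-- does not raise the filtration degree; so the state is determined by induction on the degree.
lemma inner_lift_eq (h : IsHighestWeight τ v d) (h' : IsHighestWeight σ w d) (x : Usl3) :
    ⟪v, lift ℂ τ x v⟫_ℂ = ⟪w, lift ℂ σ x w⟫_ℂ := by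
  have hpow (n : ℕ) : ∀ x ∈ generators ℂ sl3 ^ n,
      ⟪v, lift ℂ τ x v⟫_ℂ = ⟪w, lift ℂ σ x w⟫_ℂ := by
    induction n with
    | zero =>
      intro x hx
      rw [pow_zero, Submodule.mem_one] at hx
      obtain ⟨c, rfl⟩ := hx
      simp only [AlgHom.commutes, Module.algebraMap_end_apply, inner_smul_right,
        inner_self_eq_norm_sq_to_K, h.norm_eq_one, h'.norm_eq_one]
    | succ n ih =>
      intro x hx
      rw [pow_succ'] at hx
      induction hx using Submodule.mul_induction_on' with
      | mem_mul_mem m hm x hx =>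
        obtain ⟨X, rfl⟩ := hm
        have hτ := h.inner_lift_ι_mul X x
        rw [ih x hx, ih _ (lie_ι_mem_generators_pow _ hx)] at hτ
        exact hτ.trans (h'.inner_lift_ι_mul X x).symm
      | add x _ y _ hx hy =>
        simp only [map_add, LinearMap.add_apply, inner_add_right, hx, hy]
  have hx : x ∈ ⨆ n : ℕ, generators ℂ sl3 ^ n := by
    rw [iSup_generators_pow]
    exact Submodule.mem_top
  induction hx using Submodule.iSup_induction' with
  | mem n x hx => exact hpow n x hx
  | zero => simp
  | add x y _ _ hx hy => simp only [map_add, LinearMap.add_apply, inner_add_right, hx, hy]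

lemma inner_lift_lift_eq (h : IsHighestWeight τ v d) (h' : IsHighestWeight σ w d) (x y : Usl3) :
    ⟪lift ℂ τ x v, lift ℂ τ y v⟫_ℂ = ⟪lift ℂ σ x w, lift ℂ σ y w⟫_ℂ := by
  induction x using envelopingAlgebra_induction_left generalizing y with
  | one => simpa using h.inner_lift_eq h' y
  | add a b ha hb => simp only [map_add, LinearMap.add_apply, inner_add_left, ha, hb]
  | smul c a ha => simp only [map_smul, LinearMap.smul_apply, inner_smul_left, ha]
  | ι_mul X a ha =>
    have hmul := ha (ι ℂ (adj X) * y)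
    simp only [map_mul, lift_ι_apply, Module.End.mul_apply] at hmul ⊢
    rwa [← h.inner_adj, ← h'.inner_adj, adj_adj] at hmul

lemma exists_isometry (h : IsHighestWeight τ v d) (h' : IsHighestWeight σ w d)
    (hcyclic : ∀ a, ∃ x : Usl3, lift ℂ τ x v = a) :
    ∃ J : H →ₗᵢ[ℂ] K, J v = w ∧ ∀ X a, J (τ X a) = σ X (J a) := by
  choose f hf using hcyclic
  have hwell {x y : Usl3} (hxy : lift ℂ τ x v = lift ℂ τ y v) : lift ℂ σ x w = lift ℂ σ y w := by
    rw [← sub_eq_zero, ← LinearMap.sub_apply, ← map_sub, ← inner_self_eq_zero (𝕜 := ℂ),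
      ← h.inner_lift_lift_eq h', map_sub, LinearMap.sub_apply, hxy, sub_self, inner_zero_left]
  let J : H →ₗ[ℂ] K :=
    { toFun := fun a => lift ℂ σ (f a) w
      map_add' := fun a b => by
        rw [← LinearMap.add_apply, ← map_add]
        exact hwell (by rw [map_add, LinearMap.add_apply, hf, hf, hf])
      map_smul' := fun c a => by
        rw [RingHom.id_apply, ← LinearMap.smul_apply, ← map_smul]
        exact hwell (by rw [map_smul, LinearMap.smul_apply, hf, hf]) }
  have hJ (x : Usl3) : J (lift ℂ τ x v) = lift ℂ σ x w := hwell (hf _)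
  have hJv : J v = w := by simpa using hJ 1
  refine ⟨J.isometryOfInner fun a b => ?_, hJv, fun X a => ?_⟩
  · obtain ⟨x, rfl⟩ : ∃ x, lift ℂ τ x v = a := ⟨f a, hf a⟩
    obtain ⟨y, rfl⟩ : ∃ y, lift ℂ τ y v = b := ⟨f b, hf b⟩
    rw [hJ, hJ, h.inner_lift_lift_eq h']
  · obtain ⟨x, rfl⟩ : ∃ x, lift ℂ τ x v = a := ⟨f a, hf a⟩
    have hmul := hJ (ι ℂ X * x)
    rw [map_mul, map_mul, lift_ι_apply, lift_ι_apply, Module.End.mul_apply, Module.End.mul_apply,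
      ← hJ] at hmul
    exact hmul

end IsHighestWeight

end HighestWeightModules

section TensorRep

variable {R L M N : Type*} [CommRing R] [LieRing L] [LieAlgebra R L] [AddCommGroup M] [Module R M]
  [AddCommGroup N] [Module R N] (τ : L →ₗ⁅R⁆ Module.End R M) (σ : L →ₗ⁅R⁆ Module.End R N)

/-- The tensor product of two representations of a Lie algebra. -/
def tensorRep : L →ₗ⁅R⁆ Module.End R (M ⊗[R] N) where
  toFun X := TensorProduct.map (τ X) LinearMap.id + TensorProduct.map LinearMap.id (σ X)
  map_add' X Y := TensorProduct.ext' fun a b => by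
    simp only [map_add, LinearMap.add_apply, TensorProduct.map_tmul, LinearMap.id_coe, id_eq,
      TensorProduct.add_tmul, TensorProduct.tmul_add]
    abel
  map_smul' c X := TensorProduct.ext' fun a b => by
    simp [TensorProduct.smul_tmul']
  map_lie' {X Y} := TensorProduct.ext' fun a b => by
    simp only [LieHom.map_lie, Ring.lie_def, Module.End.mul_apply, LinearMap.add_apply,
      LinearMap.sub_apply, map_add, TensorProduct.map_tmul, LinearMap.id_coe, id_eq,
      TensorProduct.sub_tmul, TensorProduct.tmul_sub]
    abel

lemma tensorRep_tmul (X : L) (a : M) (b : N) :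
    tensorRep τ σ X (a ⊗ₜ b) = τ X a ⊗ₜ b + a ⊗ₜ σ X b := rfl

end TensorRep

section Compression

variable {H K : Type*} [NormedAddCommGroup H] [InnerProductSpace ℂ H]
  [NormedAddCommGroup K] [InnerProductSpace ℂ K]

lemma IsHighestWeight.tensor {τ : sl3 →ₗ⁅ℂ⁆ Module.End ℂ H} {σ : sl3 →ₗ⁅ℂ⁆ Module.End ℂ K} {v : H}
    {w : K} {d e : Fin 3 → ℝ} (h : IsHighestWeight τ v d) (h' : IsHighestWeight σ w e) :
    IsHighestWeight (tensorRep τ σ) (v ⊗ₜ[ℂ] w) (d + e) where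
  inner_adj X a b := by
    induction a using TensorProduct.induction_on with
    | zero => simp
    | add a a' ha ha' => rw [map_add, inner_add_left, inner_add_left, ha, ha']
    | tmul a a' =>
      induction b using TensorProduct.induction_on with
      | zero => simp
      | add b b' hb hb' => rw [map_add, inner_add_right, inner_add_right, hb, hb']
      | tmul b b' =>
        simp only [tensorRep_tmul, inner_add_left, inner_add_right, TensorProduct.inner_tmul,
          h.inner_adj, h'.inner_adj]
  norm_eq_one := by rw [TensorProduct.norm_tmul, h.norm_eq_one, h'.norm_eq_one, mul_one]
  apply_of_upper X hX := by
    rw [tensorRep_tmul, h.apply_of_upper X hX, h'.apply_of_upper X hX, ← TensorProduct.smul_tmul',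
      TensorProduct.tmul_smul, ← add_smul, ← Finset.sum_add_distrib]
    simp only [Pi.add_apply, Complex.ofReal_add, mul_add]

/-- The real structure underlying the complex normed space `H ⊗ K`; it takes precedence over the
real structure induced by the left factor. -/
@[reducible] def tensorRealModule : Module ℝ (H ⊗[ℂ] K) := NormedSpace.complexToReal.toModule

variable {L : Type*} [NormedAddCommGroup L] [InnerProductSpace ℂ L] [FiniteDimensional ℂ H]
  [FiniteDimensional ℂ K] [FiniteDimensional ℂ L]

/-- The compression `J† (A ⊗ B) J` of a tensor product of operators along an isometry `J`. -/
def compress (J : L →ₗᵢ[ℂ] H ⊗[ℂ] K) (A : Module.End ℂ H) (B : Module.End ℂ K) : Module.End ℂ L :=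
  have := FiniteDimensional.complete ℂ L
  have := FiniteDimensional.complete ℂ (H ⊗[ℂ] K)
  (ContinuousLinearMap.adjoint J.toContinuousLinearMap ∘L
    TensorProduct.mapL (Module.End.toContinuousLinearMap H A)
      (Module.End.toContinuousLinearMap K B) ∘L J.toContinuousLinearMap).toLinearMap

lemma inner_compress (J : L →ₗᵢ[ℂ] H ⊗[ℂ] K) (A : Module.End ℂ H) (B : Module.End ℂ K) (a b : L) :
    ⟪a, compress J A B b⟫_ℂ = ⟪J a, TensorProduct.map A B (J b)⟫_ℂ := by
  have := FiniteDimensional.complete ℂ L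
  have := FiniteDimensional.complete ℂ (H ⊗[ℂ] K)
  refine (ContinuousLinearMap.adjoint_inner_right J.toContinuousLinearMap a
    (TensorProduct.mapL (Module.End.toContinuousLinearMap H A)
      (Module.End.toContinuousLinearMap K B) (J b))).trans ?_
  rw [TensorProduct.mapL_apply]
  rfl

lemma norm_compress_le (J : L →ₗᵢ[ℂ] H ⊗[ℂ] K) (A : Module.End ℂ H) (B : Module.End ℂ K) :
    ‖Module.End.toContinuousLinearMap L (compress J A B)‖ ≤
      ‖Module.End.toContinuousLinearMap H A‖ * ‖Module.End.toContinuousLinearMap K B‖ := by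
  have := FiniteDimensional.complete ℂ L
  have := FiniteDimensional.complete ℂ (H ⊗[ℂ] K)
  have hJ := J.norm_toContinuousLinearMap_le
  have hJ' : ‖ContinuousLinearMap.adjoint J.toContinuousLinearMap‖ ≤ 1 := by
    rwa [LinearIsometryEquiv.norm_map]
  set A' := Module.End.toContinuousLinearMap H A
  set B' := Module.End.toContinuousLinearMap K B
  calc ‖ContinuousLinearMap.adjoint J.toContinuousLinearMap ∘L
        TensorProduct.mapL A' B' ∘L J.toContinuousLinearMap‖
      ≤ 1 * (‖TensorProduct.mapL A' B'‖ * 1) := by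
        grw [ContinuousLinearMap.opNorm_comp_le, ContinuousLinearMap.opNorm_comp_le, hJ, hJ']
    _ ≤ ‖A'‖ * ‖B'‖ := by rw [one_mul, mul_one]; exact TensorProduct.norm_mapL_le ..

end Compression

section CartanComponent

attribute [local instance 2000] tensorRealModule

namespace QuarkSystem

variable {ω₁ ω₂ ω₃ : Mat3} (Q₁ : QuarkSystem.{u} ω₁) (Q₂ : QuarkSystem.{u} ω₂)
  (Q₃ : QuarkSystem.{u} ω₃)

lemma op_one : Q₁.op 1 = LinearMap.id := LinearMap.ext Q₁.rep_one_apply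

lemma hasDerivAt_map_oneParam (X : su3) (z : Q₁.H ⊗[ℂ] Q₂.H) (t : ℝ) :
    HasDerivAt (fun t => TensorProduct.map (Q₁.op (oneParam X t)) (Q₂.op (oneParam X t)) z)
      (tensorRep Q₁.drep Q₂.drep X
        (TensorProduct.map (Q₁.op (oneParam X t)) (Q₂.op (oneParam X t)) z)) t := by
  induction z using TensorProduct.induction_on with
  | zero => simpa using hasDerivAt_const t (0 : Q₁.H ⊗[ℂ] Q₂.H)
  | add a b ha hb =>
    simp only [map_add]
    exact ha.fun_add hb
  | tmul a b =>
    have h := ((TensorProduct.mkL ℂ Q₁.H Q₂.H).bilinearRestrictScalars ℝ).hasDerivAt_of_bilinear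
      (fun _ => Q₁.hasDerivAt_rep_oneParam X a t) (fun _ => Q₂.hasDerivAt_rep_oneParam X b t)
    simp only [TensorProduct.map_tmul, tensorRep_tmul]
    rw [add_comm]
    exact h

variable {Q₁ Q₂ Q₃}

lemma map_rep_of_map_drep {J : Q₃.H →ₗᵢ[ℂ] Q₁.H ⊗[ℂ] Q₂.H}
    (hadj : ∀ X a b, ⟪tensorRep Q₁.drep Q₂.drep (adj X) a, b⟫_ℂ =
      ⟪a, tensorRep Q₁.drep Q₂.drep X b⟫_ℂ)
    (hJ : ∀ X a, J (Q₃.drep X a) = tensorRep Q₁.drep Q₂.drep X (J a)) (g : SU3) (a : Q₃.H) :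
    J (Q₃.rep g a) = TensorProduct.map (Q₁.op g) (Q₂.op g) (J a) := by
  obtain ⟨X, rfl⟩ := exists_oneParam_one_eq g
  have hleft (t : ℝ) : HasDerivAt (fun t => J (Q₃.rep (oneParam X t) a))
      (tensorRep Q₁.drep Q₂.drep X (J (Q₃.rep (oneParam X t) a))) t := by
    rw [← hJ]
    exact (J.toContinuousLinearMap.restrictScalars ℝ).hasFDerivAt.comp_hasDerivAt t
      (Q₃.hasDerivAt_rep_oneParam X a t)
  have hsub (t : ℝ) := (hleft t).sub (hasDerivAt_map_oneParam Q₁ Q₂ X (J a) t)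
  simp only [← map_sub] at hsub
  have hskew (b : Q₁.H ⊗[ℂ] Q₂.H) : ⟪tensorRep Q₁.drep Q₂.drep X b, b⟫_ℂ =
      -⟪b, tensorRep Q₁.drep Q₂.drep X b⟫_ℂ := by
    have hX : adj (X : sl3) = -X := Subtype.ext X.2
    rw [← hadj, hX, map_neg, LinearMap.neg_apply, inner_neg_left, neg_neg]
  refine sub_eq_zero.1 (eq_zero_of_hasDerivAt_skew hskew hsub ?_ 1)
  simp [oneParam_zero, op_one]

-- The Cartan component of the tensor product of two irreducible representations.
lemma exists_isometry_tensor {d₁ d₂ d₃ : Fin 3 → ℝ} (Q₁ : QuarkSystem.{u} (diagWeight d₁))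
    (Q₂ : QuarkSystem.{u} (diagWeight d₂)) (Q₃ : QuarkSystem.{u} (diagWeight d₃))
    (hd₁ : Antitone d₁) (hd₂ : Antitone d₂) (hd₃ : d₁ + d₂ = d₃) :
    ∃ J : Q₃.H →ₗᵢ[ℂ] Q₁.H ⊗[ℂ] Q₂.H, ∀ g,
      J (Q₃.rep g Q₃.hwVec) = Q₁.rep g Q₁.hwVec ⊗ₜ[ℂ] Q₂.rep g Q₂.hwVec := by
  subst hd₃
  have htensor := (Q₁.isHighestWeight hd₁).tensor (Q₂.isHighestWeight hd₂)
  obtain ⟨J, hJv, hJ⟩ := (Q₃.isHighestWeight (hd₁.add hd₂)).exists_isometry htensor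
    (Q₃.exists_univRep_apply_eq Q₃.hwVec_ne_zero)
  refine ⟨J, fun g => ?_⟩
  rw [map_rep_of_map_drep htensor.inner_adj hJ, hJv]
  rfl

lemma symbol_compress {J : Q₃.H →ₗᵢ[ℂ] Q₁.H ⊗[ℂ] Q₂.H} {g : SU3}
    (hJ : J (Q₃.rep g Q₃.hwVec) = Q₁.rep g Q₁.hwVec ⊗ₜ[ℂ] Q₂.rep g Q₂.hwVec)
    (A : Module.End ℂ Q₁.H) (B : Module.End ℂ Q₂.H) :
    Q₃.symbol g (compress J A B) = Q₁.symbol g A * Q₂.symbol g B := by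
  rw [symbol_apply, inner_compress, hJ, TensorProduct.map_tmul, TensorProduct.inner_tmul,
    symbol_apply, symbol_apply]

end QuarkSystem

end CartanComponent

section OperatorAsymptotics

variable {ι : Type*} {l : Filter ι} {H : ι → Type*} [∀ s, NormedAddCommGroup (H s)]
  [∀ s, InnerProductSpace ℂ (H s)] [∀ s, FiniteDimensional ℂ (H s)]

variable (l) in
/-- The operator norm of `A s`, which may act on a space depending on `s`, is `O(φ s)`
along `l`. -/
def OpIsBigO (A : ∀ s, Module.End ℂ (H s)) (φ : ι → ℝ) : Prop :=
  (fun s => ‖Module.End.toContinuousLinearMap (H s) (A s)‖) =O[l] φ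

variable {A B : ∀ s, Module.End ℂ (H s)} {φ ψ : ι → ℝ}

namespace OpIsBigO

lemma congr (hA : OpIsBigO l A φ) (h : ∀ᶠ s in l, B s = A s) : OpIsBigO l B φ :=
  Asymptotics.IsBigO.congr' hA (h.mono fun s hs => by simp only [hs]) .rfl

lemma zero : OpIsBigO l (fun s => (0 : Module.End ℂ (H s))) φ := by
  simpa [OpIsBigO] using Asymptotics.isBigO_zero φ l

lemma add (hA : OpIsBigO l A φ) (hB : OpIsBigO l B φ) : OpIsBigO l (fun s => A s + B s) φ :=
  (Asymptotics.IsBigO.of_norm_le fun s => by rw [map_add]; simpa using norm_add_le _ _).trans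
    (Asymptotics.IsBigO.add hA hB)

lemma smul {c : ι → ℂ} (hc : c =O[l] ψ) (hA : OpIsBigO l A φ) :
    OpIsBigO l (fun s => c s • A s) (fun s => ψ s * φ s) := by
  simpa only [OpIsBigO, map_smul, norm_smul] using hc.norm_left.mul hA

lemma mul (hA : OpIsBigO l A φ) (hB : OpIsBigO l B ψ) :
    OpIsBigO l (fun s => A s * B s) (fun s => φ s * ψ s) :=
  (Asymptotics.IsBigO.of_norm_le fun s => by
    rw [map_mul, norm_norm]; exact norm_mul_le _ _).trans (Asymptotics.IsBigO.mul hA hB)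

lemma const_smul (hA : OpIsBigO l A φ) (c : ℂ) : OpIsBigO l (fun s => c • A s) φ := by
  simpa using smul (Asymptotics.isBigO_const_const c one_ne_zero l) hA

lemma sub (hA : OpIsBigO l A φ) (hB : OpIsBigO l B φ) : OpIsBigO l (fun s => A s - B s) φ := by
  simpa [sub_eq_add_neg] using hA.add (hB.const_smul (-1))

end OpIsBigO

lemma OpIsBigO.inv_smul {H : ℕ → Type*} [∀ s, NormedAddCommGroup (H s)]
    [∀ s, InnerProductSpace ℂ (H s)] [∀ s, FiniteDimensional ℂ (H s)]
    {A : ∀ s, Module.End ℂ (H s)} (hA : OpIsBigO atTop A 1) :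
    OpIsBigO atTop (fun s : ℕ => (s : ℂ)⁻¹ • A s) (fun s : ℕ => (s : ℝ)⁻¹) := by
  simpa using smul (Asymptotics.IsBigO.of_norm_le (g := fun s : ℕ => (s : ℝ)⁻¹)
    fun s => by simp) hA

end OperatorAsymptotics

section Quantization

namespace QuarkSystem

variable {d : Fin 3 → ℝ} {c : ℝ}

lemma HasSymbol.unique {Q : QuarkSystem.{u} (diagWeight (c • d))} (hd : Antitone d) (hc : 0 < c)
    {A B : Module.End ℂ Q.H} {P : PolySu3} (hA : Q.HasSymbol (diagWeight d) A P)
    (hB : Q.HasSymbol (diagWeight d) B P) : A = B := by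
  refine sub_eq_zero.1 (eq_zero_of_hasSymbol_zero hd hc fun g => ?_)
  rw [map_sub, hA, hB, sub_self, map_zero]

lemma exists_hasSymbol_X_mul (hd : Antitone d) (j : Fin 8) (P : PolySu3) :
    ∃ R : PolySu3, ∀ c : ℝ, 0 < c → ∀ (Q : QuarkSystem.{u} (diagWeight (c • d)))
      (A : Module.End ℂ Q.H), Q.HasSymbol (diagWeight d) A P →
        Q.HasSymbol (diagWeight d) ((Complex.I * c)⁻¹ • (Q.drep (Esu j) * A))
          (MvPolynomial.X j * P + (c : ℂ)⁻¹ • R) := by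
  obtain ⟨t, ht⟩ := exists_symbol_drep_mul hd (Esu j)
  refine ⟨Complex.I⁻¹ • ∑ k, t k * -poissonBracket (MvPolynomial.X k) P,
    fun c hc Q A hA g => ?_⟩
  have hc0 : (c : ℂ) ≠ 0 := Complex.ofReal_ne_zero.2 hc.ne'
  have hlie (k : Fin 8) := hA.lie k g
  rw [map_smul, ht c hc Q A g, hA g]
  simp only [hlie, map_add, map_mul, map_sum, MvPolynomial.eval_X, MvPolynomial.smul_eval,
    coord_eq, coe_Esu, smul_eq_mul]
  field_simp

lemma hasSymbol_X (Q : QuarkSystem.{u} (diagWeight (c • d))) (hd : Antitone d) (hc : 0 < c)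
    (j : Fin 8) : Q.HasSymbol (diagWeight d) ((Complex.I * c)⁻¹ • Q.drep (Esu j))
      (MvPolynomial.X j) := by
  obtain ⟨t, ht⟩ := exists_symbol_drep_mul hd (Esu j)
  intro g
  have hc0 : (c : ℂ) ≠ 0 := Complex.ofReal_ne_zero.2 hc.ne'
  have h := ht c hc Q 1 g
  simp only [Ring.lie_def, mul_one, one_mul, sub_self, map_zero, mul_zero,
    Finset.sum_const_zero, add_zero, Q.symbol_one] at h
  rw [map_smul, h, MvPolynomial.eval_X, coord_eq, coe_Esu, smul_eq_mul]
  field_simp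

variable {ω : Mat3} (Q : QuarkSystem.{u} ω)

open Classical in
/-- The operator whose symbol on the orbit of `ξ` is the restriction of `P`, with the value `0` if
there is none. -/
def quant (ξ : Mat3) (P : PolySu3) : Module.End ℂ Q.H :=
  if h : ∃ A, Q.HasSymbol ξ A P then h.choose else 0

variable {Q}

lemma hasSymbol_quant {ξ : Mat3} {P : PolySu3} (h : ∃ A, Q.HasSymbol ξ A P) :
    Q.HasSymbol ξ (Q.quant ξ P) P := by
  rw [quant, dif_pos h]
  exact h.choose_spec

end QuarkSystem

open QuarkSystem

variable {r : ℝ} {d : Fin 3 → ℝ} (Q : ∀ s : ℕ, QuarkSystem.{u} (diagWeight ((s * r : ℝ) • d)))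

lemma exists_isometry_add (hd : Antitone d) (hr : 0 ≤ r) (m n : ℕ) :
    ∃ J : (Q (m + n)).H →ₗᵢ[ℂ] (Q m).H ⊗[ℂ] (Q n).H, ∀ g,
      J ((Q (m + n)).rep g (Q (m + n)).hwVec) =
        (Q m).rep g (Q m).hwVec ⊗ₜ[ℂ] (Q n).rep g (Q n).hwVec := by
  have hantitone (k : ℕ) : Antitone ((k * r : ℝ) • d) := hd.const_smul (mul_nonneg k.cast_nonneg hr)
  refine exists_isometry_tensor (Q m) (Q n) (Q (m + n)) (hantitone m) (hantitone n) ?_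
  rw [← add_smul, ← add_mul, Nat.cast_add]

-- Compression to the Cartan component multiplies symbols, so that `X j * P` is reached at level
-- `s + 1` from `P` at level `s`.
lemma exists_forall_ge_exists_hasSymbol (hd : Antitone d) (hr : 0 < r) (P : PolySu3) :
    ∃ k : ℕ, ∀ s ≥ k, ∃ A, (Q s).HasSymbol (diagWeight d) A P := by
  induction P using MvPolynomial.induction_on with
  | C a =>
    rw [MvPolynomial.C_eq_smul_one]
    exact ⟨0, fun s _ => ⟨_, (hasSymbol_one _).smul a⟩⟩
  | add P R hP hR =>
    obtain ⟨k, hP⟩ := hP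
    obtain ⟨l, hR⟩ := hR
    refine ⟨max k l, fun s hs => ?_⟩
    obtain ⟨A, hA⟩ := hP s (le_of_max_le_left hs)
    obtain ⟨B, hB⟩ := hR s (le_of_max_le_right hs)
    exact ⟨A + B, hA.add hB⟩
  | mul_X P j hP =>
    obtain ⟨k, hP⟩ := hP
    refine ⟨k + 1, fun s hs => ?_⟩
    obtain ⟨n, rfl⟩ := Nat.exists_eq_add_of_le' (Nat.one_le_of_lt hs)
    obtain ⟨A, hA⟩ := hP n (Nat.le_of_succ_le_succ hs)
    have hX := (Q 1).hasSymbol_X hd (by simpa using hr) j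
    obtain ⟨J, hJ⟩ := exists_isometry_add Q hd hr.le n 1
    exact ⟨_, fun g => by rw [symbol_compress (hJ g), hA, hX, map_mul]⟩

lemma eventually_hasSymbol_quant (hd : Antitone d) (hr : 0 < r) (P : PolySu3) :
    ∀ᶠ s : ℕ in atTop, 0 < s * r ∧
      (Q s).HasSymbol (diagWeight d) ((Q s).quant (diagWeight d) P) P := by
  obtain ⟨k, hk⟩ := exists_forall_ge_exists_hasSymbol Q hd hr P
  filter_upwards [eventually_ge_atTop k, eventually_gt_atTop 0] with s hs hpos
  exact ⟨by positivity, hasSymbol_quant (hk s hs)⟩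

variable {Q} in
lemma eventually_quant_eq (hd : Antitone d) (hr : 0 < r) {P : PolySu3}
    {A : ∀ s, Module.End ℂ (Q s).H}
    (hA : ∀ᶠ s : ℕ in atTop, (Q s).HasSymbol (diagWeight d) (A s) P) :
    ∀ᶠ s : ℕ in atTop, (Q s).quant (diagWeight d) P = A s := by
  filter_upwards [eventually_hasSymbol_quant Q hd hr P, hA] with s ⟨hpos, hP⟩ hA
  exact hP.unique hd hpos hA

-- At every later level the operator is the compression of `A ⊗ 1`, for a fixed `A`.
lemma opIsBigO_quant (hd : Antitone d) (hr : 0 < r) (P : PolySu3) :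
    OpIsBigO atTop (fun s => (Q s).quant (diagWeight d) P) 1 := by
  obtain ⟨k, hk⟩ := exists_forall_ge_exists_hasSymbol Q hd hr P
  obtain ⟨A, hA⟩ := hk k le_rfl
  refine Asymptotics.IsBigO.of_bound ‖Module.End.toContinuousLinearMap (Q k).H A‖ ?_
  filter_upwards [eventually_ge_atTop k, eventually_hasSymbol_quant Q hd hr P]
    with s hs ⟨hpos, hP⟩
  obtain ⟨n, rfl⟩ := Nat.exists_eq_add_of_le hs
  obtain ⟨J, hJ⟩ := exists_isometry_add Q hd hr.le k n
  have hcompress : (Q (k + n)).HasSymbol (diagWeight d) (compress J A 1) P := fun g => by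
    rw [symbol_compress (hJ g), hA, symbol_one, mul_one]
  rw [hP.unique hd hpos hcompress, norm_norm, Pi.one_apply, norm_one, mul_one]
  refine (norm_compress_le J A 1).trans (mul_le_of_le_one_right (norm_nonneg _) ?_)
  rw [map_one]
  exact ContinuousLinearMap.norm_id_le

lemma eventually_quant_one (hd : Antitone d) (hr : 0 < r) :
    ∀ᶠ s in atTop, (Q s).quant (diagWeight d) 1 = 1 :=
  eventually_quant_eq hd hr (.of_forall fun _ => hasSymbol_one _)

lemma eventually_quant_add (hd : Antitone d) (hr : 0 < r) (P R : PolySu3) :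
    ∀ᶠ s in atTop, (Q s).quant (diagWeight d) (P + R) =
      (Q s).quant (diagWeight d) P + (Q s).quant (diagWeight d) R := by
  refine eventually_quant_eq hd hr ?_
  filter_upwards [eventually_hasSymbol_quant Q hd hr P, eventually_hasSymbol_quant Q hd hr R]
    with s hP hR
  exact hP.2.add hR.2

lemma eventually_quant_smul (hd : Antitone d) (hr : 0 < r) (a : ℂ) (P : PolySu3) :
    ∀ᶠ s in atTop, (Q s).quant (diagWeight d) (a • P) = a • (Q s).quant (diagWeight d) P := by
  refine eventually_quant_eq hd hr ?_
  filter_upwards [eventually_hasSymbol_quant Q hd hr P] with s hP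
  exact hP.2.smul a

lemma eventually_quant_X (hd : Antitone d) (hr : 0 < r) (j : Fin 8) :
    ∀ᶠ s : ℕ in atTop, (Q s).quant (diagWeight d) (MvPolynomial.X j) =
      (Complex.I * (s * r : ℝ))⁻¹ • (Q s).drep (Esu j) := by
  refine eventually_quant_eq hd hr ?_
  filter_upwards [eventually_gt_atTop 0] with s hs
  exact (Q s).hasSymbol_X hd (by positivity) j

lemma exists_quant_X_mul (hd : Antitone d) (hr : 0 < r) (j : Fin 8) (P : PolySu3) :
    ∃ R : PolySu3, ∀ᶠ s : ℕ in atTop,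
      (Q s).quant (diagWeight d) (MvPolynomial.X j) * (Q s).quant (diagWeight d) P =
        (Q s).quant (diagWeight d) (MvPolynomial.X j * P) +
          (s : ℂ)⁻¹ • (Q s).quant (diagWeight d) R := by
  obtain ⟨R, hR⟩ := exists_hasSymbol_X_mul.{u} hd j P
  refine ⟨(r : ℂ)⁻¹ • R, ?_⟩
  filter_upwards [eventually_hasSymbol_quant Q hd hr P, eventually_quant_X Q hd hr j,
    eventually_hasSymbol_quant Q hd hr (MvPolynomial.X j * P),
    eventually_hasSymbol_quant Q hd hr ((r : ℂ)⁻¹ • R)] with s ⟨hpos, hP⟩ hX hXP hrR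
  rw [hX, smul_mul_assoc]
  refine (hR _ hpos (Q s) _ hP).unique hd hpos ?_
  have hscale : ((s * r : ℝ) : ℂ)⁻¹ • R = (s : ℂ)⁻¹ • (r : ℂ)⁻¹ • R := by
    rw [smul_smul, Complex.ofReal_mul, mul_inv, Complex.ofReal_natCast]
  rw [hscale]
  exact hXP.2.add (hrR.2.smul _)

lemma eventually_lie_quant_X (hd : Antitone d) (hr : 0 < r) (j : Fin 8) (P : PolySu3) :
    ∀ᶠ s : ℕ in atTop, ((s * r : ℝ) : ℂ) •
        ⁅(Q s).quant (diagWeight d) (MvPolynomial.X j), (Q s).quant (diagWeight d) P⁆ =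
      Complex.I • (Q s).quant (diagWeight d) (poissonBracket (MvPolynomial.X j) P) := by
  filter_upwards [eventually_hasSymbol_quant Q hd hr P, eventually_quant_X Q hd hr j,
    eventually_hasSymbol_quant Q hd hr (poissonBracket (MvPolynomial.X j) P)]
    with s ⟨hpos, hP⟩ hX hbracket
  have hscale : ((s * r : ℝ) : ℂ) * (Complex.I * (s * r : ℝ))⁻¹ = -Complex.I := by
    have hpos' : ((s * r : ℝ) : ℂ) ≠ 0 := Complex.ofReal_ne_zero.2 hpos.ne'
    rw [mul_inv, mul_left_comm, mul_inv_cancel₀ hpos', mul_one, Complex.inv_I]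
  rw [hX, smul_lie, smul_smul, hscale]
  refine ((hP.lie j).smul (-Complex.I)).unique hd hpos ?_
  rw [smul_neg, neg_smul, neg_neg]
  exact hbracket.2.smul Complex.I

lemma opIsBigO_quant_mul (hd : Antitone d) (hr : 0 < r) (P R : PolySu3) :
    OpIsBigO atTop (fun s : ℕ => (Q s).quant (diagWeight d) P * (Q s).quant (diagWeight d) R -
      (Q s).quant (diagWeight d) (P * R)) (fun s : ℕ => (s : ℝ)⁻¹) := by
  induction P using MvPolynomial.induction_on generalizing R with
  | C a =>
    rw [MvPolynomial.C_eq_smul_one, smul_one_mul]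
    refine OpIsBigO.zero.congr ?_
    filter_upwards [eventually_quant_one Q hd hr, eventually_quant_smul Q hd hr a 1,
      eventually_quant_smul Q hd hr a R] with s hone ha haR
    rw [ha, hone, haR, smul_one_mul, sub_self]
  | add P P' hP hP' =>
    refine ((hP R).add (hP' R)).congr ?_
    filter_upwards [eventually_quant_add Q hd hr P P',
      eventually_quant_add Q hd hr (P * R) (P' * R)] with s hadd hmul
    rw [add_mul P, hadd, hmul]
    noncomm_ring
  | mul_X P j hP =>
    obtain ⟨S, hS⟩ := exists_quant_X_mul Q hd hr j P
    obtain ⟨T, hT⟩ := exists_quant_X_mul Q hd hr j (P * R)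
    have hX := (opIsBigO_quant Q hd hr (MvPolynomial.X j)).mul (hP R)
    have hSR := (opIsBigO_quant Q hd hr S).inv_smul.mul (opIsBigO_quant Q hd hr R)
    simp only [Pi.one_apply, one_mul, mul_one] at hX hSR
    refine ((hX.add (opIsBigO_quant Q hd hr T).inv_smul).sub hSR).congr ?_
    filter_upwards [hS, hT] with s hS hT
    rw [mul_comm P, mul_assoc, mul_sub, hT, ← mul_assoc ((Q s).quant _ (MvPolynomial.X j)), hS]
    noncomm_ring

lemma opIsBigO_lie_quant (hd : Antitone d) (hr : 0 < r) (P R : PolySu3) :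
    OpIsBigO atTop (fun s : ℕ => ⁅(Q s).quant (diagWeight d) P, (Q s).quant (diagWeight d) R⁆)
      (fun s : ℕ => (s : ℝ)⁻¹) := by
  refine ((opIsBigO_quant_mul Q hd hr P R).sub (opIsBigO_quant_mul Q hd hr R P)).congr
    (.of_forall fun s => ?_)
  rw [mul_comm R P, Ring.lie_def, sub_sub_sub_cancel_right]

lemma lie_mul_left {A : Type*} [Ring A] (a b c : A) : ⁅a * b, c⁆ = a * ⁅b, c⁆ + ⁅a, c⁆ * b := by
  simp only [Ring.lie_def]
  noncomm_ring

lemma poissonBracket_add_left (P P' R : PolySu3) :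
    poissonBracket (P + P') R = poissonBracket P R + poissonBracket P' R := by
  simp only [poissonBracket, map_add, add_mul, mul_add, Finset.sum_add_distrib]

lemma poissonBracket_mul_left (P P' R : PolySu3) :
    poissonBracket (P * P') R = P * poissonBracket P' R + poissonBracket P R * P' := by
  simp only [poissonBracket, Derivation.leibniz, smul_eq_mul, Finset.mul_sum, Finset.sum_mul,
    ← Finset.sum_add_distrib]
  refine Finset.sum_congr rfl fun j _ => Finset.sum_congr rfl fun k _ =>
    Finset.sum_congr rfl fun l _ => ?_
  ring

lemma poissonBracket_C_left (a : ℂ) (R : PolySu3) : poissonBracket (MvPolynomial.C a) R = 0 := by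
  simp [poissonBracket]

-- Both the commutator and the Poisson bracket are derivations in `P`, and the claim is exact for
-- `P = X j`.
lemma opIsBigO_lie_quant_sub_quant_poissonBracket (hd : Antitone d) (hr : 0 < r) (P R : PolySu3) :
    OpIsBigO atTop (fun s : ℕ => ((s * r : ℝ) : ℂ) •
        ⁅(Q s).quant (diagWeight d) P, (Q s).quant (diagWeight d) R⁆ -
      Complex.I • (Q s).quant (diagWeight d) (poissonBracket P R)) (fun s : ℕ => (s : ℝ)⁻¹) := by
  induction P using MvPolynomial.induction_on with
  | C a =>
    refine OpIsBigO.zero.congr ?_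
    filter_upwards [eventually_quant_one Q hd hr, eventually_quant_smul Q hd hr a 1,
      eventually_quant_smul Q hd hr 0 0] with s hone ha hzero
    rw [poissonBracket_C_left, ← zero_smul ℂ 0, hzero, MvPolynomial.C_eq_smul_one, ha, hone]
    simp [Ring.lie_def]
  | add P P' hP hP' =>
    refine (hP.add hP').congr ?_
    filter_upwards [eventually_quant_add Q hd hr P P',
      eventually_quant_add Q hd hr (poissonBracket P R) (poissonBracket P' R)] with s hadd hbracket
    rw [poissonBracket_add_left, hadd, hbracket, add_lie]
    module
  | mul_X P j hP =>
    obtain ⟨S, hS⟩ := exists_quant_X_mul Q hd hr j P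
    have hX := (opIsBigO_quant Q hd hr (MvPolynomial.X j)).mul hP
    simp only [Pi.one_apply, one_mul] at hX
    have hbracket := opIsBigO_quant_mul Q hd hr (MvPolynomial.X j) (poissonBracket P R)
    have hbracket' := opIsBigO_quant_mul Q hd hr (poissonBracket (MvPolynomial.X j) R) P
    refine (((hX.add (hbracket.const_smul Complex.I)).add (hbracket'.const_smul Complex.I)).sub
      ((opIsBigO_lie_quant Q hd hr S R).const_smul r)).congr ?_
    filter_upwards [hS, eventually_lie_quant_X Q hd hr j R, eventually_quant_add Q hd hr
      (MvPolynomial.X j * poissonBracket P R) (poissonBracket (MvPolynomial.X j) R * P),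
      eventually_gt_atTop 0] with s hS hlie hadd hs
    have hr' : (r : ℂ) = ((s * r : ℝ) : ℂ) * (s : ℂ)⁻¹ := by
      rw [Complex.ofReal_mul, Complex.ofReal_natCast, mul_comm (s : ℂ),
        mul_inv_cancel_right₀ (Nat.cast_ne_zero.2 hs.ne')]
    rw [mul_comm P, poissonBracket_mul_left, hadd, ← sub_eq_iff_eq_add.2 hS, hr', sub_lie, smul_lie,
      lie_mul_left, smul_sub, smul_add, ← smul_mul_assoc _ ⁅_, (Q s).quant _ R⁆, hlie]
    simp only [mul_sub, mul_smul_comm, smul_mul_assoc]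
    module

end Quantization

section Conclusion

lemma orbitPt_surjective (ξ : Mat3) : Function.Surjective (orbitPt ξ) := by
  rintro ⟨_, g, rfl⟩
  exact ⟨g, rfl⟩

namespace QuarkSystem

variable {ω : Mat3} (Q : QuarkSystem.{u} ω)

lemma norm_symbol_le (A : Module.End ℂ Q.H) (g : SU3) :
    ‖Q.symbol g A‖ ≤ ‖Module.End.toContinuousLinearMap Q.H A‖ :=
  calc ‖⟪Q.rep g Q.hwVec, A (Q.rep g Q.hwVec)⟫_ℂ‖
      ≤ ‖Q.rep g Q.hwVec‖ * ‖A (Q.rep g Q.hwVec)‖ := norm_inner_le_norm _ _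
    _ = ‖A (Q.rep g Q.hwVec)‖ := by rw [norm_rep_hwVec, one_mul]
    _ ≤ ‖Module.End.toContinuousLinearMap Q.H A‖ * ‖Q.rep g Q.hwVec‖ :=
      (Module.End.toContinuousLinearMap Q.H A).le_opNorm _
    _ = ‖Module.End.toContinuousLinearMap Q.H A‖ := by rw [norm_rep_hwVec, mul_one]

lemma univBerezin_eq_restrict {ξ : Mat3} {x : Usl3} {P : PolySu3}
    (h : Q.HasSymbol ξ (Q.univRep x) P) : Q.univBerezin ξ x = restrict ξ P := by
  funext X
  change LinearMap.trace ℂ Q.H (Q.univRep x * Q.hwProjAt X.2.choose) = _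
  rw [trace_mul_hwProjAt, h, restrict]
  exact congrArg (fun Y => MvPolynomial.eval (coord Y) P) X.2.choose_spec

lemma mem_range_univBerezin {ξ : Mat3} {A : Module.End ℂ Q.H} {P : PolySu3}
    (h : Q.HasSymbol ξ A P) : restrict ξ P ∈ Set.range (Q.univBerezin ξ) := by
  obtain ⟨x, rfl⟩ := Q.univRep_surjective A
  exact ⟨x, Q.univBerezin_eq_restrict h⟩

variable {d : Fin 3 → ℝ} {c : ℝ} (Q : QuarkSystem.{u} (diagWeight (c • d)))

lemma univBerezin_orbitPt (hd : Antitone d) (hc : 0 < c) (x : Usl3) (g : SU3) :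
    Q.univBerezin (diagWeight d) x (orbitPt (diagWeight d) g) = Q.symbol g (Q.univRep x) := by
  obtain ⟨P, hP⟩ := Q.exists_hasSymbol hd hc x
  rw [Q.univBerezin_eq_restrict hP, hP g]
  rfl

lemma isBerezin_univBerezin (hd : Antitone d) (hc : 0 < c) :
    Q.IsBerezin (diagWeight d) (Q.univBerezin (diagWeight d)) := by
  intro x
  obtain ⟨P, hP⟩ := Q.exists_hasSymbol hd hc x
  refine ⟨⟨P, (Q.univBerezin_eq_restrict hP).symm⟩, fun g => ?_⟩
  rw [trace_mul_hwProjAt, Q.univBerezin_orbitPt hd hc]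

lemma univRep_eq_of_univBerezin_eq (hd : Antitone d) (hc : 0 < c) {x y : Usl3}
    (h : Q.univBerezin (diagWeight d) x = Q.univBerezin (diagWeight d) y) :
    Q.univRep x = Q.univRep y := by
  obtain ⟨P, hP⟩ := Q.exists_hasSymbol hd hc x
  refine hP.unique hd hc fun g => ?_
  rw [← Q.univBerezin_orbitPt hd hc, ← h, Q.univBerezin_orbitPt hd hc, hP]

lemma twistedProdWellDefined_univBerezin (hd : Antitone d) (hc : 0 < c) :
    TwistedProdWellDefined (Q.univBerezin (diagWeight d)) := by
  intro x y
  have h : (∃ u, Q.univBerezin (diagWeight d) u = Q.univBerezin (diagWeight d) x) ∧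
      ∃ v, Q.univBerezin (diagWeight d) v = Q.univBerezin (diagWeight d) y := ⟨⟨x, rfl⟩, ⟨y, rfl⟩⟩
  have hmul : Q.univRep (h.1.choose * h.2.choose) = Q.univRep (x * y) := by
    rw [map_mul, map_mul, Q.univRep_eq_of_univBerezin_eq hd hc h.1.choose_spec,
      Q.univRep_eq_of_univBerezin_eq hd hc h.2.choose_spec]
  rw [twistedProd, dif_pos h]
  exact congrArg (Q.berezinSymbol (diagWeight d)) hmul

lemma twistedProd_orbitPt (hd : Antitone d) (hc : 0 < c) {A B : Module.End ℂ Q.H} {P R : PolySu3}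
    (hA : Q.HasSymbol (diagWeight d) A P) (hB : Q.HasSymbol (diagWeight d) B R) (g : SU3) :
    twistedProd (Q.univBerezin (diagWeight d)) (restrict (diagWeight d) P)
      (restrict (diagWeight d) R) (orbitPt (diagWeight d) g) = Q.symbol g (A * B) := by
  obtain ⟨x, rfl⟩ := Q.univRep_surjective A
  obtain ⟨y, rfl⟩ := Q.univRep_surjective B
  rw [← Q.univBerezin_eq_restrict hA, ← Q.univBerezin_eq_restrict hB,
    Q.twistedProdWellDefined_univBerezin hd hc x y, Q.univBerezin_orbitPt hd hc, map_mul]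

end QuarkSystem

lemma tendstoUniformly_of_opIsBigO {ι : Type*} {l : Filter ι} {ω : ι → Mat3}
    {Q : ∀ s, QuarkSystem.{u} (ω s)} {ξ : Mat3} {A : ∀ s, Module.End ℂ (Q s).H} {φ : ι → ℝ}
    (hA : OpIsBigO l A φ) (hφ : Tendsto φ l (nhds 0)) {F : ι → orbit ξ → ℂ} {f : orbit ξ → ℂ}
    (h : ∀ᶠ s in l, ∀ g, F s (orbitPt ξ g) - f (orbitPt ξ g) = (Q s).symbol g (A s)) :
    TendstoUniformly F f l := by
  rw [Metric.tendstoUniformly_iff]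
  intro ε hε
  filter_upwards [h, (Asymptotics.IsBigO.trans_tendsto hA hφ).eventually (gt_mem_nhds hε)]
    with s h hlt X
  obtain ⟨g, rfl⟩ := orbitPt_surjective ξ X
  rw [dist_comm, dist_eq_norm, h g]
  exact ((Q s).norm_symbol_le _ g).trans_lt hlt

section

variable {r : ℝ} {d : Fin 3 → ℝ} (Q : ∀ s : ℕ, QuarkSystem.{u} (diagWeight ((s * r : ℝ) • d)))

lemma eventually_twistedProd_orbitPt (hd : Antitone d) (hr : 0 < r) (P R : PolySu3) :
    ∀ᶠ s in atTop, ∀ g, twistedProd ((Q s).univBerezin (diagWeight d)) (restrict (diagWeight d) P)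
        (restrict (diagWeight d) R) (orbitPt (diagWeight d) g) =
      (Q s).symbol g ((Q s).quant (diagWeight d) P * (Q s).quant (diagWeight d) R) := by
  filter_upwards [eventually_hasSymbol_quant Q hd hr P, eventually_hasSymbol_quant Q hd hr R]
    with s ⟨hpos, hP⟩ hR g
  exact (Q s).twistedProd_orbitPt hd hpos hP hR.2 g

lemma tendstoUniformly_twistedProd (hd : Antitone d) (hr : 0 < r) (P R : PolySu3) :
    TendstoUniformly (fun s => twistedProd ((Q s).univBerezin (diagWeight d))
        (restrict (diagWeight d) P) (restrict (diagWeight d) R))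
      (restrict (diagWeight d) P * restrict (diagWeight d) R) atTop := by
  refine tendstoUniformly_of_opIsBigO (opIsBigO_quant_mul Q hd hr P R)
    tendsto_inv_atTop_nhds_zero_nat ?_
  filter_upwards [eventually_twistedProd_orbitPt Q hd hr P R,
    eventually_hasSymbol_quant Q hd hr (P * R)] with s hprod ⟨_, hPR⟩ g
  rw [hprod g, map_sub, hPR g, map_mul (MvPolynomial.eval _)]
  rfl

lemma tendstoUniformly_twistedComm (hd : Antitone d) (hr : 0 < r) (P R : PolySu3) :
    TendstoUniformly (fun s : ℕ => (s * r) • twistedComm ((Q s).univBerezin (diagWeight d))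
        (restrict (diagWeight d) P) (restrict (diagWeight d) R))
      (Complex.I • restrict (diagWeight d) (poissonBracket P R)) atTop := by
  refine tendstoUniformly_of_opIsBigO (opIsBigO_lie_quant_sub_quant_poissonBracket Q hd hr P R)
    tendsto_inv_atTop_nhds_zero_nat ?_
  filter_upwards [eventually_twistedProd_orbitPt Q hd hr P R,
    eventually_twistedProd_orbitPt Q hd hr R P,
    eventually_hasSymbol_quant Q hd hr (poissonBracket P R)] with s hPR hRP ⟨_, hbracket⟩ g
  rw [map_sub ((Q s).symbol g), map_smul ((Q s).symbol g), map_smul ((Q s).symbol g), Ring.lie_def,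
    map_sub ((Q s).symbol g), hbracket g, ← hPR g, ← hRP g]
  rfl

end

lemma isBerezin_and_twistedProdWellDefined {ω : Mat3} {d : Fin 3 → ℝ} {c : ℝ} (hd : Antitone d)
    (hc : 0 < c) (hω : ω = diagWeight (c • d)) (Q : QuarkSystem.{u} ω) :
    Q.IsBerezin (diagWeight d) (Q.univBerezin (diagWeight d)) ∧
      TwistedProdWellDefined (Q.univBerezin (diagWeight d)) := by
  subst hω
  exact ⟨Q.isBerezin_univBerezin hd hc, Q.twistedProdWellDefined_univBerezin hd hc⟩

lemma isPoissonType {ω : ℕ → Mat3} {d : Fin 3 → ℝ} (hd : Antitone d)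
    (hr : 0 < integralRadius (diagWeight d))
    (hω : ∀ s : ℕ, ω s = diagWeight ((s * integralRadius (diagWeight d) : ℝ) • d))
    (Q : ∀ s, QuarkSystem.{u} (ω s)) :
    IsPoissonType (diagWeight d) (fun s => (Q s).univBerezin (diagWeight d)) := by
  obtain rfl := funext hω
  constructor
  · rintro _ ⟨P, rfl⟩
    obtain ⟨k, hk⟩ := exists_forall_ge_exists_hasSymbol Q hd hr P
    exact ⟨k, fun s hs => (hk s hs).elim fun _ hA => (Q s).mem_range_univBerezin hA⟩
  · rintro _ ⟨P, rfl⟩ _ ⟨R, rfl⟩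
    refine ⟨tendstoUniformly_twistedProd Q hd hr P R, fun F₁ F₂ h₁ h₂ => ?_⟩
    rw [← h₁, ← h₂]
    exact tendstoUniformly_twistedComm Q hd hr F₁ F₂

lemma smul_firstWeight (s : ℝ) (d : Fin 3 → ℝ) : s • firstWeight (diagWeight d) =
    diagWeight ((s * integralRadius (diagWeight d)) • d) := by
  rw [firstWeight, ← map_smul, ← map_smul, smul_smul]

end Conclusion

end Quark

end

theorem theorem3p6 (ξ : Quark.Mat3) (hξ : ξ ∈ Quark.rationalArc)
    (Q : ∀ s : ℕ, Quark.QuarkSystem ((s : ℝ) • Quark.firstWeight ξ)) :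
    (∀ s : ℕ, 1 ≤ s → (Q s).IsBerezin ξ ((Q s).univBerezin ξ) ∧
      Quark.TwistedProdWellDefined ((Q s).univBerezin ξ)) ∧
    Quark.IsPoissonType ξ (fun s => (Q s).univBerezin ξ) := by
  obtain ⟨x, y, hx, hy, -, rfl⟩ := Quark.exists_eq_diagWeight_of_mem_arc hξ.1
  have hd := Quark.antitone_weightEntries hx hy
  have hr := Quark.integralRadius_pos hξ
  have hω (s : ℝ) := Quark.smul_firstWeight s (Quark.weightEntries x y)
  refine ⟨fun s hs => ?_, Quark.isPoissonType hd hr (fun s => hω s) Q⟩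
  exact Quark.isBerezin_and_twistedProdWellDefined hd (mul_pos (Nat.cast_pos.2 hs) hr) (hω s) (Q s)
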